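/- Let $R$ be a commutative quasi-Frobenius ring (i.e. $R$ is Artinian and injective as an $R$-module). Algebras are unital, comodules are counital, and $\otimes=\otimes_R$. A measuring pairing $P=(A,C)$ consists of an $R$-algebra $A$, an $R$-coalgebra $C$ and a morphism of $R$-algebras $\kappa_P:A\to C^*=\mathrm{Hom}_R(C,R)$, where $C^*$ carries the convolution product $(f\star g)(c)=\sum f(c_1)g(c_2)$; write $\langle a,c\rangle=\kappa_P(a)(c)$. It is a measuring $\alpha$-pairing if for every $R$-module $M$ the map $\alpha_M^P:M\otimes C\to\mathrm{Hom}_R(A,M)$, $m\otimes c\mapsto[a\mapsto\langle a,c\rangle m]$, is injective. For a measuring $\alpha$-pairing $(A,C)$ and a left $A$-module $M$, let $\mathrm{Rat}^C({}_AM)$ be the $A$-submodule of those $m\in M$ for which $[a\mapsto am]\in\alpha_M^P(M\otimes C)$, and let $\mathrm{Rat}^C({}_A\mathcal M)$ be the full subcategory of left $A$-modules $M$ with $\mathrm{Rat}^C({}_AM)=M$. The full subcategory ${}^C\mathrm{Rat}(\mathcal M_A)$ of right $A$-modules is defined symmetrically. Every left $C$-comodule $M$ is an object of ${}^C\mathrm{Rat}(\mathcal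 M_A)$ through $ma=\sum\langle a,m_{\langle -1\rangle}\rangle m_{\langle 0\rangle}$. Let $P=(A,C)$ and $Q=(B,D)$ be measuring $\alpha$-pairings over $R$ and let $(\xi,\theta):(B,D)\to(A,C)$ be a morphism of measuring pairings, i.e. $\xi:A\to B$ is an $R$-algebra morphism and $\theta:D\to C$ is an $R$-coalgebra morphism with $\langle\xi(a),d\rangle=\langle a,\theta(d)\rangle$ for all $a\in A$, $d\in D$. The coinduction functor is $$\mathrm{Coind}_P^Q:\mathrm{Rat}^C({}_A\mathcal M)\to\mathrm{Rat}^D({}_B\mathcal M),\qquad M\mapsto\mathrm{Rat}^D\bigl({}_B\mathrm{Hom}_{A-}(B,M)\bigr),$$ where $\mathrm{Hom}_{A-}(B,M)$ is the set of left $A$-linear maps ($B$ being a left $A$-module via $\xi$), with the left $B$-action $(bf)(x)=f(xb)$. Every left $D$-comodule $(M,\varrho_M)$ is regarded as a left $C$-comodule through $(\theta\otimes\mathrm{id}_M)\circ\varrho_M$; in particular this applies to $D$ (with $\varrho_D=\Delta_D$). For a right $C$-comodule $M$ and a left $C$-comodule $N$, let $M\square_CN=\ker(\varrho_M\otimes\mathrm{id}_N-\mathrm{id}_M\otimes\varrho_N:M\otimes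 N\to M\otimes C\otimes N)$; $N$ is called coflat if $-\square_CN$ is an exact functor from right $C$-comodules to $R$-modules. Then the following are equivalent: 1. the functor $\mathrm{Coind}_P^Q:\mathrm{Rat}^C({}_A\mathcal M)\to\mathrm{Rat}^D({}_B\mathcal M)$ is exact; 2. $D$ is coflat as a left $C$-comodule; 3. $D$ is injective in ${}^C\mathrm{Rat}(\mathcal M_A)$; 4. every left $D$-comodule $M$ that is injective in the category of left $D$-comodules and flat as an $R$-module is injective in ${}^C\mathrm{Rat}(\mathcal M_A)$. -/

import Mathlib

open scoped TensorProduct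

universe u

/-- A (commutative) quasi-Frobenius ring: Artinian and injective as a module over itself. -/
class IsQuasiFrobenius (R : Type u) [CommRing R] : Prop where
  artinian : IsArtinianRing R
  selfInjective : Module.Injective R R

/-! ### Comodules -/

/-- A right `C`-comodule structure on the `R`-module `M` (coassociative and counital). -/
class RightComodule (R C M : Type u) [CommRing R] [AddCommGroup C] [Module R C] [Coalgebra R C]
    [AddCommGroup M] [Module R M] where
  coact : M →ₗ[R] M ⊗[R] C
  coassoc : (TensorProduct.assoc R M C C).toLinearMap ∘ₗ coact.rTensor C ∘ₗ coact =
    (Coalgebra.comul (R := R) (A := C)).lTensor M ∘ₗ coact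
  counital : (TensorProduct.rid R M).toLinearMap ∘ₗ
    (Coalgebra.counit (R := R) (A := C)).lTensor M ∘ₗ coact = LinearMap.id

/-- A left `C`-comodule structure on the `R`-module `M` (coassociative and counital). -/
class LeftComodule (R C M : Type u) [CommRing R] [AddCommGroup C] [Module R C] [Coalgebra R C]
    [AddCommGroup M] [Module R M] where
  coact : M →ₗ[R] C ⊗[R] M
  coassoc : (TensorProduct.assoc R C C M).toLinearMap ∘ₗ
    (Coalgebra.comul (R := R) (A := C)).rTensor M ∘ₗ coact = coact.lTensor C ∘ₗ coact
  counital : (TensorProduct.lid R M).toLinearMap ∘ₗ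
    (Coalgebra.counit (R := R) (A := C)).rTensor M ∘ₗ coact = LinearMap.id

/-- An `R`-linear map of right comodules is colinear if it commutes with the coactions. -/
def RightComodule.IsColinear {R : Type u} (C : Type u) {M N : Type u} [CommRing R]
    [AddCommGroup C] [Module R C] [Coalgebra R C] [AddCommGroup M] [Module R M]
    [AddCommGroup N] [Module R N] [RightComodule R C M] [RightComodule R C N]
    (f : M →ₗ[R] N) : Prop :=
  coact (R := R) (C := C) (M := N) ∘ₗ f = f.rTensor C ∘ₗ coact (R := R) (C := C) (M := M)

/-- An `R`-linear map of left comodules is colinear if it commutes with the coactions. -/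
def LeftComodule.IsColinear {R : Type u} (C : Type u) {M N : Type u} [CommRing R]
    [AddCommGroup C] [Module R C] [Coalgebra R C] [AddCommGroup M] [Module R M]
    [AddCommGroup N] [Module R N] [LeftComodule R C M] [LeftComodule R C N]
    (f : M →ₗ[R] N) : Prop :=
  coact (R := R) (C := C) (M := N) ∘ₗ f = f.lTensor C ∘ₗ coact (R := R) (C := C) (M := M)

/-- Injective object of the category of left `C`-comodules (for `C` flat over `R`, where the
monomorphisms are the injective colinear maps). -/
def LeftComodule.IsInjective (R C E : Type u) [CommRing R] [AddCommGroup C] [Module R C]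
    [Coalgebra R C] [AddCommGroup E] [Module R E] [LeftComodule R C E] : Prop :=
  ∀ (X Y : Type u) [AddCommGroup X] [Module R X] [LeftComodule R C X]
    [AddCommGroup Y] [Module R Y] [LeftComodule R C Y] (i : X →ₗ[R] Y) (f : X →ₗ[R] E),
    LeftComodule.IsColinear C i → Function.Injective i → LeftComodule.IsColinear C f →
    ∃ g : Y →ₗ[R] E, LeftComodule.IsColinear C g ∧ g ∘ₗ i = f

/-- A coalgebra is a left comodule over itself through its comultiplication. -/
instance LeftComodule.self (R C : Type u) [CommRing R] [AddCommGroup C] [Module R C]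
    [Coalgebra R C] : LeftComodule R C C where
  coact := Coalgebra.comul
  coassoc := Coalgebra.coassoc
  counital := by
    ext c
    simp

section Cotensor

variable (R C : Type u) [CommRing R] [AddCommGroup C] [Module R C] [Coalgebra R C]

/-- The cotensor product `M □_C N`, the kernel of
`ϱ_M ⊗ id_N - id_M ⊗ ϱ_N : M ⊗ N → M ⊗ C ⊗ N`. -/
noncomputable def Cotensor (M N : Type u) [AddCommGroup M] [Module R M] [RightComodule R C M]
    [AddCommGroup N] [Module R N] [LeftComodule R C N] : Submodule R (M ⊗[R] N) :=
  LinearMap.ker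
    ((TensorProduct.assoc R M C N).toLinearMap ∘ₗ
        (RightComodule.coact (R := R) (C := C) (M := M)).rTensor N -
      (LeftComodule.coact (R := R) (C := C) (M := N)).lTensor M)

variable {R}
variable {M M' : Type u} [AddCommGroup M] [Module R M] [RightComodule R C M]
  [AddCommGroup M'] [Module R M'] [RightComodule R C M']

theorem Cotensor.map_mem (N : Type u) [AddCommGroup N] [Module R N] [LeftComodule R C N]
    (f : M →ₗ[R] M') (hf : RightComodule.IsColinear C f)
    (x : M ⊗[R] N) (hx : x ∈ Cotensor R C M N) : f.rTensor N x ∈ Cotensor R C M' N := by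
  have h1 : ∀ y : (M ⊗[R] C) ⊗[R] N, TensorProduct.assoc R M' C N ((f.rTensor C).rTensor N y) =
      f.rTensor (C ⊗[R] N) (TensorProduct.assoc R M C N y) := by
    intro y
    exact LinearMap.congr_fun (f := (TensorProduct.assoc R M' C N).toLinearMap ∘ₗ
      (f.rTensor C).rTensor N) (g := f.rTensor (C ⊗[R] N) ∘ₗ
      (TensorProduct.assoc R M C N).toLinearMap) (by ext; simp) y
  have h2 : (RightComodule.coact (R := R) (C := C) (M := M')).rTensor N (f.rTensor N x) =
      (f.rTensor C).rTensor N ((RightComodule.coact (R := R) (C := C) (M := M)).rTensor N x) := by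
    rw [← LinearMap.rTensor_comp_apply, ← LinearMap.rTensor_comp_apply, hf]
  have h3 : (LeftComodule.coact (R := R) (C := C) (M := N)).lTensor M' (f.rTensor N x) =
      f.rTensor (C ⊗[R] N) ((LeftComodule.coact (R := R) (C := C) (M := N)).lTensor M x) := by
    rw [← LinearMap.comp_apply, ← LinearMap.comp_apply, LinearMap.lTensor_comp_rTensor,
      LinearMap.rTensor_comp_lTensor]
  simp only [Cotensor, LinearMap.mem_ker, LinearMap.sub_apply, LinearMap.comp_apply,
    LinearEquiv.coe_coe, sub_eq_zero] at hx ⊢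
  rw [h2, h1, h3, hx]

/-- The map `f □_C N : M □_C N → M' □_C N` induced by a colinear map `f`. -/
noncomputable def Cotensor.map (N : Type u) [AddCommGroup N] [Module R N] [LeftComodule R C N]
    (f : M →ₗ[R] M') (hf : RightComodule.IsColinear C f) :
    Cotensor R C M N →ₗ[R] Cotensor R C M' N :=
  (f.rTensor N).restrict (Cotensor.map_mem C N f hf)

end Cotensor

/-- A left comodule `N` over the (flat) coalgebra `C` is coflat if the functor `- □_C N` from right
`C`-comodules to `R`-modules is exact, i.e. preserves short exact sequences. -/
def LeftComodule.IsCoflat (R C N : Type u) [CommRing R] [AddCommGroup C] [Module R C]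
    [Coalgebra R C] [AddCommGroup N] [Module R N] [LeftComodule R C N] : Prop :=
  ∀ (L M K : Type u) [AddCommGroup L] [Module R L] [RightComodule R C L]
    [AddCommGroup M] [Module R M] [RightComodule R C M]
    [AddCommGroup K] [Module R K] [RightComodule R C K]
    (f : L →ₗ[R] M) (g : M →ₗ[R] K)
    (hf : RightComodule.IsColinear C f) (hg : RightComodule.IsColinear C g),
    Function.Injective f → Function.Exact f g → Function.Surjective g →
    Function.Injective (Cotensor.map C N f hf) ∧
      Function.Exact (Cotensor.map C N f hf) (Cotensor.map C N g hg) ∧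
      Function.Surjective (Cotensor.map C N g hg)

section Corestriction

variable {R C D : Type u} [CommRing R] [AddCommGroup C] [Module R C] [Coalgebra R C]
  [AddCommGroup D] [Module R D] [Coalgebra R D]

variable (θ : D →ₗc[R] C) (M : Type u) [AddCommGroup M] [Module R M]

/-- Corestriction along `θ : D → C`: the left `C`-coaction `(θ ⊗ id_M) ∘ ϱ_M`. -/
@[reducible] noncomputable def LeftComodule.corestrict (h : LeftComodule R D M) : LeftComodule R C M :=
  LeftComodule.mk (M := M) (θ.toLinearMap.rTensor M ∘ₗ h.coact)
    (by
      have hθ := θ.map_comp_comul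
      have key : ∀ y : D ⊗[R] M, TensorProduct.assoc R C C M
          ((Coalgebra.comul (R := R) (A := C)).rTensor M (θ.toLinearMap.rTensor M y)) =
          TensorProduct.map θ.toLinearMap (θ.toLinearMap.rTensor M)
            (TensorProduct.assoc R D D M
              ((Coalgebra.comul (R := R) (A := D)).rTensor M y)) := by
        intro y
        rw [← LinearMap.rTensor_comp_apply, ← hθ, LinearMap.rTensor_comp_apply]
        generalize (Coalgebra.comul (R := R) (A := D)).rTensor M y = z
        exact LinearMap.congr_fun (f := (TensorProduct.assoc R C C M).toLinearMap ∘ₗ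
          (TensorProduct.map θ.toLinearMap θ.toLinearMap).rTensor M)
          (g := TensorProduct.map θ.toLinearMap (θ.toLinearMap.rTensor M) ∘ₗ
            (TensorProduct.assoc R D D M).toLinearMap) (by ext; simp) z
      ext m
      have hc := LinearMap.congr_fun h.coassoc m
      simp only [LinearMap.comp_apply, LinearEquiv.coe_coe] at hc ⊢
      rw [key, hc]
      generalize h.coact m = y
      exact LinearMap.congr_fun (f := TensorProduct.map θ.toLinearMap (θ.toLinearMap.rTensor M) ∘ₗ
        h.coact.lTensor D) (g := (θ.toLinearMap.rTensor M ∘ₗ h.coact).lTensor C ∘ₗ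
          θ.toLinearMap.rTensor M) (by ext; simp) y)
    (by
      rw [← h.counital]
      ext m
      simp only [LinearMap.comp_apply]
      rw [← LinearMap.rTensor_comp_apply, θ.counit_comp])

/-- The left `D`-comodule `M`, regarded as a left `C`-comodule along the coalgebra morphism
`θ : D → C`. -/
@[nolint unusedArguments]
def Corestrict (_θ : D →ₗc[R] C) (M : Type u) : Type u := M

instance : AddCommGroup (Corestrict θ M) := inferInstanceAs (AddCommGroup M)

instance : Module R (Corestrict θ M) := inferInstanceAs (Module R M)

noncomputable instance [h : LeftComodule R D M] : LeftComodule R C (Corestrict θ M) :=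
  LeftComodule.corestrict θ M h

end Corestriction

/-! ### Measuring pairings -/

/-- A measuring `R`-pairing `(A, C)`: an `R`-algebra `A`, an `R`-coalgebra `C` and a morphism of
`R`-algebras from `A` to the convolution algebra `C^*`. -/
structure MeasuringPairing (R A C : Type u) [CommRing R] [Ring A] [Algebra R A]
    [AddCommGroup C] [Module R C] [Coalgebra R C] where
  κ : A →ₐ[R] WithConv (C →ₗ[R] R)

namespace MeasuringPairing

section

variable {R A C : Type u} [CommRing R] [Ring A] [Algebra R A]
  [AddCommGroup C] [Module R C] [Coalgebra R C] (P : MeasuringPairing R A C)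

/-- The bilinear form `⟨a, c⟩`, as a linear map in each variable. -/
noncomputable def form : A →ₗ[R] C →ₗ[R] R where
  toFun a := (P.κ a).ofConv
  map_add' a b := by simp
  map_smul' r a := by
    rw [map_smul]
    rfl

/-- `α_M : M ⊗ C → Hom_R(A, M)`, `m ⊗ c ↦ [a ↦ ⟨a, c⟩ m]`. -/
noncomputable def alpha (M : Type u) [AddCommGroup M] [Module R M] :
    M ⊗[R] C →ₗ[R] (A →ₗ[R] M) :=
  TensorProduct.lift (LinearMap.mk₂ R (fun m c => (P.form.flip c).smulRight m)
    (fun m m' c => by ext a; simp)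
    (fun r m c => by ext a; simp [smul_smul, mul_comm])
    (fun m c c' => by ext a; simp [add_smul])
    (fun r m c => by ext a; simp [mul_smul]))

@[simp] theorem alpha_tmul (M : Type u) [AddCommGroup M] [Module R M] (m : M) (c : C) (a : A) :
    P.alpha M (m ⊗ₜ c) a = P.form a c • m := by
  simp [alpha]

/-- The `α`-condition. -/
def AlphaCondition : Prop :=
  ∀ (M : Type u) [AddCommGroup M] [Module R M], Function.Injective (P.alpha M)

/-- The left `A`-action `a ⇀ c = ∑ c₁ ⟨a, c₂⟩` on `C`. -/
noncomputable def leftAct (a : A) : C →ₗ[R] C :=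
  (TensorProduct.rid R C).toLinearMap ∘ₗ (P.form a).lTensor C ∘ₗ Coalgebra.comul

theorem form_mul (a b : A) : P.form (a * b) =
    LinearMap.mul' R R ∘ₗ TensorProduct.map (P.form a) (P.form b) ∘ₗ Coalgebra.comul := by
  simp only [form, LinearMap.coe_mk, AddHom.coe_mk, map_mul]
  rfl

theorem form_one : P.form 1 = Coalgebra.counit := by
  ext c
  simp [form]

theorem form_leftAct (a b : A) (c : C) : P.form a (P.leftAct b c) = P.form (a * b) c := by
  rw [form_mul]
  simp only [leftAct, LinearMap.comp_apply]
  generalize Coalgebra.comul (R := R) c = z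
  induction z with
  | zero => simp
  | tmul x y => simp [mul_comm]
  | add x y hx hy => simp only [map_add, hx, hy]

theorem alpha_lTensor_leftAct (M : Type u) [AddCommGroup M] [Module R M] (a b : A)
    (t : M ⊗[R] C) : P.alpha M ((P.leftAct b).lTensor M t) a = P.alpha M t (a * b) := by
  induction t with
  | zero => simp
  | tmul x y => simp [form_leftAct]
  | add x y hx hy => simp only [map_add, LinearMap.add_apply, hx, hy]

theorem alpha_rTensor {M N : Type u} [AddCommGroup M] [Module R M] [AddCommGroup N] [Module R N]
    (f : M →ₗ[R] N) (a : A) (t : M ⊗[R] C) :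
    P.alpha N (f.rTensor C t) a = f (P.alpha M t a) := by
  induction t with
  | zero => simp
  | tmul x y => simp
  | add x y hx hy => simp only [map_add, LinearMap.add_apply, hx, hy]

section Left

variable (M : Type u) [AddCommGroup M] [Module R M] [Module A M] [IsScalarTower R A M]

/-- `Rat^C(_A M)`: the `m ∈ M` for which `[a ↦ a m]` lies in the image of `M ⊗ C`. -/
noncomputable def rat : Submodule A M where
  carrier := {m | ∃ t : M ⊗[R] C, ∀ a : A, P.alpha M t a = a • m}
  zero_mem' := ⟨0, by simp⟩
  add_mem' := by
    rintro x y ⟨s, hs⟩ ⟨t, ht⟩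
    exact ⟨s + t, by simp [hs, ht]⟩
  smul_mem' := by
    rintro b x ⟨s, hs⟩
    exact ⟨(P.leftAct b).lTensor M s, fun a => by
      rw [alpha_lTensor_leftAct, hs, mul_smul]⟩

/-- `M` belongs to `Rat^C(_A 𝓜)`. -/
def IsRational : Prop := P.rat M = ⊤

variable {M}
variable {N : Type u} [AddCommGroup N] [Module R N] [Module A N] [IsScalarTower R A N]

theorem map_mem_rat (f : M →ₗ[A] N) (m : M) (hm : m ∈ P.rat M) : f m ∈ P.rat N := by
  obtain ⟨t, ht⟩ := hm
  refine ⟨(f.restrictScalars R).rTensor C t, fun a => ?_⟩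
  rw [alpha_rTensor, ht]
  simp

/-- The action of the functor `Rat^C(-)` on morphisms. -/
noncomputable def ratMap (f : M →ₗ[A] N) : P.rat M →ₗ[A] P.rat N :=
  f.restrict (P.map_mem_rat f)

/-- `Rat^C(_A M)` is again a `C`-rational `A`-module. -/
theorem isRational_rat (hP : P.AlphaCondition) : P.IsRational (P.rat M) := by
  refine (Submodule.eq_top_iff' (p := P.rat (P.rat M))).2 ?_
  rintro ⟨m, hm⟩
  obtain ⟨t, ht⟩ := id hm
  let S : Submodule R M := (P.rat M).restrictScalars R
  have hz : S.mkQ.rTensor C t = 0 := by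
    apply hP (M ⧸ S)
    ext a
    rw [alpha_rTensor, ht, map_zero, LinearMap.zero_apply]
    exact (Submodule.Quotient.mk_eq_zero S).2 ((P.rat M).smul_mem a hm)
  have hex : Function.Exact S.subtype S.mkQ := LinearMap.exact_subtype_mkQ S
  obtain ⟨s, hs⟩ := (rTensor_exact C hex S.mkQ_surjective t).1 hz
  refine ⟨s, fun a => Subtype.ext ?_⟩
  have h := P.alpha_rTensor S.subtype a s
  rw [hs, ht] at h
  exact h.symm

end Left

section Right

/-- `α`-map for right `A`-modules: `C ⊗ M → Hom_R(A, M)`, `c ⊗ m ↦ [a ↦ ⟨a, c⟩ m]`. -/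
noncomputable def alphaRight (M : Type u) [AddCommGroup M] [Module R M] :
    C ⊗[R] M →ₗ[R] (A →ₗ[R] M) :=
  P.alpha M ∘ₗ (TensorProduct.comm R C M).toLinearMap

/-- The right `A`-module `M` belongs to `^C Rat(𝓜_A)`: for every `m ∈ M` the map `[a ↦ m a]` lies
in the image of `C ⊗ M`. Right `A`-modules are modules over `Aᵐᵒᵖ`. -/
def IsRightRational (M : Type u) [AddCommGroup M] [Module R M] [Module Aᵐᵒᵖ M]
    [IsScalarTower R Aᵐᵒᵖ M] : Prop :=
  ∀ m : M, ∃ t : C ⊗[R] M, ∀ a : A, P.alphaRight M t a = MulOpposite.op a • m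

/-- `E` is an injective object of the category `^C Rat(𝓜_A)`. -/
def IsInjectiveRightRational (E : Type u) [AddCommGroup E] [Module R E] [Module Aᵐᵒᵖ E]
    [IsScalarTower R Aᵐᵒᵖ E] : Prop :=
  P.IsRightRational E ∧
  ∀ (X Y : Type u) [AddCommGroup X] [Module R X] [Module Aᵐᵒᵖ X] [IsScalarTower R Aᵐᵒᵖ X]
    [AddCommGroup Y] [Module R Y] [Module Aᵐᵒᵖ Y] [IsScalarTower R Aᵐᵒᵖ Y]
    (i : X →ₗ[Aᵐᵒᵖ] Y) (f : X →ₗ[Aᵐᵒᵖ] E), P.IsRightRational X → P.IsRightRational Y →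
    Function.Injective i → ∃ g : Y →ₗ[Aᵐᵒᵖ] E, g ∘ₗ i = f

/-- The left `C`-comodule `M`, regarded as a right `A`-module through
`m a = ∑ ⟨a, m₍₋₁₎⟩ m₍₀₎`. -/
@[nolint unusedArguments]
def RightModuleOf (_P : MeasuringPairing R A C) (M : Type u) : Type u := M

variable (M : Type u) [AddCommGroup M] [Module R M]

instance : AddCommGroup (P.RightModuleOf M) := inferInstanceAs (AddCommGroup M)

instance : Module R (P.RightModuleOf M) := inferInstanceAs (Module R M)

variable [LeftComodule R C M]

/-- The map `m ↦ ∑ ⟨a, m₍₋₁₎⟩ m₍₀₎`. -/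
noncomputable def rightAct (a : A) : M →ₗ[R] M :=
  (TensorProduct.lid R M).toLinearMap ∘ₗ (P.form a).rTensor M ∘ₗ
    LeftComodule.coact (R := R) (C := C) (M := M)

theorem rightAct_one : P.rightAct M 1 = LinearMap.id := by
  rw [rightAct, form_one]
  exact LeftComodule.counital

theorem rightAct_add (a b : A) : P.rightAct M (a + b) = P.rightAct M a + P.rightAct M b := by
  simp only [rightAct, map_add, LinearMap.rTensor_add, LinearMap.add_comp, LinearMap.comp_add]

theorem rightAct_zero : P.rightAct M 0 = 0 := by
  simp only [rightAct, map_zero, LinearMap.rTensor_zero, LinearMap.zero_comp, LinearMap.comp_zero]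

theorem rightAct_smul (r : R) (a : A) : P.rightAct M (r • a) = r • P.rightAct M a := by
  simp only [rightAct, map_smul, LinearMap.rTensor_smul, LinearMap.smul_comp, LinearMap.comp_smul]

theorem rightAct_mul (a b : A) (m : M) :
    P.rightAct M (a * b) m = P.rightAct M b (P.rightAct M a m) := by
  have hc : (Coalgebra.comul (R := R) (A := C)).rTensor M
      (LeftComodule.coact (R := R) (C := C) m) = (TensorProduct.assoc R C C M).symm
        ((LeftComodule.coact (R := R) (C := C) (M := M)).lTensor C
          (LeftComodule.coact (R := R) (C := C) m)) := by
    rw [LinearEquiv.eq_symm_apply]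
    exact LinearMap.congr_fun (LeftComodule.coassoc (R := R) (C := C) (M := M)) m
  have h1 : (TensorProduct.lid R M).toLinearMap ∘ₗ
      (LinearMap.mul' R R ∘ₗ TensorProduct.map (P.form a) (P.form b)).rTensor M ∘ₗ
      (TensorProduct.assoc R C C M).symm.toLinearMap =
      (TensorProduct.lid R M).toLinearMap ∘ₗ (P.form b).rTensor M ∘ₗ
        (TensorProduct.lid R (C ⊗[R] M)).toLinearMap ∘ₗ (P.form a).rTensor (C ⊗[R] M) := by
    ext x y z
    simp [mul_smul]
  have h2 : (TensorProduct.lid R (C ⊗[R] M)).toLinearMap ∘ₗ (P.form a).rTensor (C ⊗[R] M) ∘ₗ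
      (LeftComodule.coact (R := R) (C := C) (M := M)).lTensor C =
      LeftComodule.coact (R := R) (C := C) (M := M) ∘ₗ
        (TensorProduct.lid R M).toLinearMap ∘ₗ (P.form a).rTensor M := by
    ext x y
    simp
  have e1 := LinearMap.congr_fun h1 ((LeftComodule.coact (R := R) (C := C) (M := M)).lTensor C
          (LeftComodule.coact (R := R) (C := C) m))
  have e2 := LinearMap.congr_fun h2 (LeftComodule.coact (R := R) (C := C) m)
  simp only [LinearMap.comp_apply, LinearEquiv.coe_coe] at e1 e2
  rw [e2, ← hc, ← LinearMap.rTensor_comp_apply, LinearMap.comp_assoc, ← form_mul] at e1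
  exact e1

noncomputable instance : Module Aᵐᵒᵖ (P.RightModuleOf M) where
  smul a m := P.rightAct M a.unop m
  one_smul m := LinearMap.congr_fun (P.rightAct_one M) m
  mul_smul a b m := P.rightAct_mul M b.unop a.unop m
  smul_zero a := (P.rightAct M a.unop).map_zero
  smul_add a := (P.rightAct M a.unop).map_add
  add_smul a b m := by
    exact LinearMap.congr_fun (P.rightAct_add M a.unop b.unop) m
  zero_smul m := by
    exact LinearMap.congr_fun (P.rightAct_zero M) m

instance : IsScalarTower R Aᵐᵒᵖ (P.RightModuleOf M) where
  smul_assoc r a m := by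
    exact LinearMap.congr_fun (P.rightAct_smul M r a.unop) m

end Right

end

/-- A morphism of measuring pairings `(ξ, θ) : (B, D) → (A, C)`: an algebra morphism `ξ : A → B` and
a coalgebra morphism `θ : D → C` with `⟨ξ a, d⟩ = ⟨a, θ d⟩`. -/
structure Hom {R A B C D : Type u} [CommRing R] [Ring A] [Algebra R A] [Ring B] [Algebra R B]
    [AddCommGroup C] [Module R C] [Coalgebra R C] [AddCommGroup D] [Module R D] [Coalgebra R D]
    (Q : MeasuringPairing R B D) (P : MeasuringPairing R A C) where
  ξ : A →ₐ[R] B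
  θ : D →ₗc[R] C
  form_eq : ∀ (a : A) (d : D), Q.form (ξ a) d = P.form a (θ d)

end MeasuringPairing

/-! ### Coinduction -/

section HomOver

variable {R A B : Type u} [CommRing R] [Ring A] [Algebra R A] [Ring B] [Algebra R B]
  (ξ : A →ₐ[R] B)

/-- `Hom_{A-}(B, M)`, the left `A`-linear maps from `B` to `M`, where `B` is a left `A`-module along
`ξ`, as an `R`-submodule of `Hom_R(B, M)`. -/
def homOverSubmodule (M : Type u) [AddCommGroup M] [Module R M] [Module A M]
    [IsScalarTower R A M] : Submodule R (B →ₗ[R] M) where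
  carrier := {f | ∀ (a : A) (b : B), f (ξ a * b) = a • f b}
  zero_mem' := by simp
  add_mem' := by
    intro f g hf hg a b
    simp [hf a b, hg a b]
  smul_mem' := by
    intro r f hf a b
    rw [LinearMap.smul_apply, LinearMap.smul_apply, hf a b, ← algebraMap_smul A r (f b),
      ← algebraMap_smul A r (a • f b), ← mul_smul, ← mul_smul, Algebra.commutes]

/-- `Hom_{A-}(B, M)` as a type, to carry the left `B`-module structure. -/
def HomOver (M : Type u) [AddCommGroup M] [Module R M] [Module A M]
    [IsScalarTower R A M] : Type u := homOverSubmodule ξ M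

variable (M : Type u) [AddCommGroup M] [Module R M] [Module A M] [IsScalarTower R A M]

instance : AddCommGroup (HomOver ξ M) := inferInstanceAs (AddCommGroup (homOverSubmodule ξ M))

instance : Module R (HomOver ξ M) := inferInstanceAs (Module R (homOverSubmodule ξ M))

/-- The left `B`-module structure `(b f)(x) = f(x b)`. -/
instance : Module B (HomOver ξ M) where
  smul b f := ⟨f.1 ∘ₗ LinearMap.mulRight R b, fun a x => by
    simpa [mul_assoc] using f.2 a (x * b)⟩
  one_smul f := Subtype.ext (LinearMap.ext fun x => congrArg f.1 (mul_one x))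
  mul_smul b c f := Subtype.ext (LinearMap.ext fun x => congrArg f.1 (mul_assoc x b c).symm)
  smul_zero _ := rfl
  smul_add _ _ _ := rfl
  add_smul b c f := Subtype.ext (LinearMap.ext fun x =>
    (congrArg f.1 (mul_add x b c)).trans (f.1.map_add _ _))
  zero_smul f := Subtype.ext (LinearMap.ext fun x =>
    (congrArg f.1 (mul_zero x)).trans f.1.map_zero)

instance : IsScalarTower R B (HomOver ξ M) where
  smul_assoc r b f := Subtype.ext (LinearMap.ext fun x =>
    (congrArg f.1 (mul_smul_comm r x b)).trans (f.1.map_smul r _))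

variable {M}
variable {N : Type u} [AddCommGroup N] [Module R N] [Module A N] [IsScalarTower R A N]

/-- `Hom_{A-}(B, g) : f ↦ g ∘ f`. -/
def HomOver.map (g : M →ₗ[A] N) : HomOver ξ M →ₗ[B] HomOver ξ N where
  toFun f := ⟨(g.restrictScalars R) ∘ₗ f.1, fun a b => by
    have h := f.2 a b
    simp [h]⟩
  map_add' f f' := Subtype.ext (LinearMap.ext fun x => g.map_add (f.1 x) (f'.1 x))
  map_smul' _ _ := rfl

end HomOver

section Coind

variable {R A B C D : Type u} [CommRing R] [Ring A] [Algebra R A] [Ring B] [Algebra R B]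
  [AddCommGroup C] [Module R C] [Coalgebra R C] [AddCommGroup D] [Module R D] [Coalgebra R D]
  {P : MeasuringPairing R A C} {Q : MeasuringPairing R B D}

/-- `Coind_P^Q(M) = Rat^D(Hom_{A-}(B, M))`, a left `B`-module. -/
noncomputable def Coind (φ : MeasuringPairing.Hom Q P) (M : Type u) [AddCommGroup M] [Module R M]
    [Module A M] [IsScalarTower R A M] : Submodule B (HomOver φ.ξ M) :=
  Q.rat (HomOver φ.ξ M)

/-- The functor `Coind_P^Q` on morphisms. -/
noncomputable def Coind.map (φ : MeasuringPairing.Hom Q P) {M N : Type u} [AddCommGroup M]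
    [Module R M] [Module A M] [IsScalarTower R A M] [AddCommGroup N] [Module R N] [Module A N]
    [IsScalarTower R A N] (g : M →ₗ[A] N) : Coind φ M →ₗ[B] Coind φ N :=
  Q.ratMap (HomOver.map φ.ξ g)

/-- `Coind_P^Q` takes values in `Rat^D(_B 𝓜)`. -/
theorem Coind.isRational (hQ : Q.AlphaCondition) (φ : MeasuringPairing.Hom Q P) (M : Type u)
    [AddCommGroup M] [Module R M] [Module A M] [IsScalarTower R A M] :
    Q.IsRational (Coind φ M) :=
  Q.isRational_rat hQ

/-- The functor `Coind_P^Q : Rat^C(_A 𝓜) → Rat^D(_B 𝓜)` is exact: it preserves short exact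
sequences. -/
def Coind.IsExact (φ : MeasuringPairing.Hom Q P) : Prop :=
  ∀ (L M K : Type u) [AddCommGroup L] [Module R L] [Module A L] [IsScalarTower R A L]
    [AddCommGroup M] [Module R M] [Module A M] [IsScalarTower R A M]
    [AddCommGroup K] [Module R K] [Module A K] [IsScalarTower R A K]
    (f : L →ₗ[A] M) (g : M →ₗ[A] K),
    P.IsRational L → P.IsRational M → P.IsRational K →
    Function.Injective f → Function.Exact f g → Function.Surjective g →
    Function.Injective (Coind.map φ f) ∧ Function.Exact (Coind.map φ f) (Coind.map φ g) ∧
      Function.Surjective (Coind.map φ g)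

end Coind

/-! ### Linear algebra over quasi-Frobenius rings -/

/-! All four conditions are compared with one lifting property, `LiftsBalanced`: for every
surjection `M → K` of rational left `A`-modules, each tensor in `K ⊗ E` on which the two `A`-actions
agree lifts to such a tensor in `M ⊗ E`. The main case is `E = D`, which is flat by the α-condition.

Condition 2: under the α-condition right `C`-comodules are the rational left `A`-modules, and `M □_C
E` is the module of balanced tensors (`mem_cotensor_iff_isBalanced`). Flatness of `E` gives left
exactness, so coflatness is the lifting property.

Condition 1: `α` identifies the balanced tensors in `M ⊗ D` with `Coind M`
(`isBalanced_corestrict_iff`, `mem_coind_iff`), so exactness of coinduction is the same property.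

Condition 3: over a quasi-Frobenius ring dualising is exact and finitely generated modules are
reflexive. For `X` finitely generated and `E` flat, `X^* ⊗ E ≃ Hom(X, E)` matches balanced tensors
with `A`-linear maps, so lifting along `M → K` is extending along `K^* → M^*`. Rational modules are
locally finite over `R`, which reduces lifting to finitely generated modules directly and extension
by a Baer-type argument.

Condition 4: `D` is injective over itself because `R` is self-injective, so 4 gives 3. Conversely a
flat injective `D`-comodule `M` is a retract of the cofree comodule `D ⊗ M`, and the lifting
property survives tensoring with a flat module and passing to retracts. -/

theorem Module.Injective.exists_comp_eq {R Q X Y : Type u} [Ring R] [AddCommGroup Q] [Module R Q]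
    [AddCommGroup X] [Module R X] [AddCommGroup Y] [Module R Y] (hQ : Module.Injective R Q)
    (i : X →ₗ[R] Y) (hi : Function.Injective i) (f : X →ₗ[R] Q) :
    ∃ g : Y →ₗ[R] Q, g ∘ₗ i = f := by
  obtain ⟨g, hg⟩ := hQ.out i hi f
  exact ⟨g, LinearMap.ext hg⟩

section QuasiFrobenius

variable (R : Type u) [CommRing R] [hR : IsQuasiFrobenius R]

instance IsQuasiFrobenius.isArtinianRing : IsArtinianRing R := hR.artinian

variable {R}

/-- Over an Artinian commutative ring every maximal ideal is the annihilator of an element. -/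
theorem exists_ne_zero_forall_mul_eq_zero {S : Type u} [CommRing S] [IsArtinianRing S]
    (m : Ideal S) [hm : m.IsMaximal] : ∃ z : S, z ≠ 0 ∧ ∀ r ∈ m, r * z = 0 := by
  -- Primes of an Artinian ring are maximal, so `m` is minimal over the zero annihilator and is
  -- therefore an associated prime.
  have hmin : m ∈ (Module.annihilator S S).minimalPrimes := by
    refine ⟨⟨hm.isPrime, by rw [Module.annihilator_eq_bot.2 inferInstance]; exact bot_le⟩, ?_⟩
    rintro q ⟨hq, -⟩ hle
    have : q.IsMaximal := IsArtinianRing.isMaximal_of_isPrime q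
    exact (this.eq_of_le hm.ne_top hle).ge
  obtain ⟨-, z, hz⟩ := Submodule.isAssociatedPrime_iff.1
    (Module.associatedPrimes.minimalPrimes_annihilator_subset_associatedPrimes
      (M := S) (R := S) hmin)
  refine ⟨z, ?_, fun r hr => ?_⟩
  · rintro rfl
    apply hm.ne_top
    rw [hz]
    simp
  · rw [hz, Submodule.mem_colon_singleton] at hr
    simpa using hr

/-- A quasi-Frobenius ring is a cogenerator. -/
theorem exists_dual_apply_ne_zero {N : Type u} [AddCommGroup N] [Module R N] {x : N}
    (hx : x ≠ 0) : ∃ f : Module.Dual R N, f x ≠ 0 := by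
  let j : R →ₗ[R] N := LinearMap.toSpanSingleton R N x
  have hne : LinearMap.ker j ≠ ⊤ := by
    intro h
    apply hx
    have : (1 : R) ∈ LinearMap.ker j := h ▸ Submodule.mem_top
    simpa [j] using this
  obtain ⟨m, hm, hle⟩ := Ideal.exists_le_maximal _ hne
  obtain ⟨z, hz, hmz⟩ := exists_ne_zero_forall_mul_eq_zero m
  -- The annihilator of `x` lies in `m`, which kills `z`, so `r x ↦ r z` is well defined on `R x`;
  -- self-injectivity extends it to `N`.
  let k : R →ₗ[R] R := LinearMap.toSpanSingleton R R z
  have hk : LinearMap.ker j ≤ LinearMap.ker k := fun r hr => hmz r (hle hr)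
  obtain ⟨g, hg⟩ := hR.selfInjective.exists_comp_eq ((LinearMap.ker j).liftQ j le_rfl)
    (LinearMap.ker_eq_bot.1 (Submodule.ker_liftQ_eq_bot _ _ _ le_rfl))
    ((LinearMap.ker j).liftQ k hk)
  refine ⟨g, ?_⟩
  have h1 : g (j 1) = k 1 := LinearMap.congr_fun hg (Submodule.Quotient.mk 1)
  have h2 : g x = z := by simpa [j, k] using h1
  rwa [h2]

theorem Module.Dual.eval_injective_of_isQuasiFrobenius (N : Type u) [AddCommGroup N]
    [Module R N] : Function.Injective (Module.Dual.eval R N) := by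
  rw [injective_iff_map_eq_zero]
  intro x hx
  by_contra hne
  obtain ⟨f, hf⟩ := exists_dual_apply_ne_zero (R := R) hne
  exact hf (LinearMap.congr_fun hx f)

theorem LinearMap.dualMap_surjective_of_isQuasiFrobenius {X Y : Type u} [AddCommGroup X]
    [Module R X] [AddCommGroup Y] [Module R Y] {i : X →ₗ[R] Y} (hi : Function.Injective i) :
    Function.Surjective i.dualMap :=
  fun f => hR.selfInjective.exists_comp_eq i hi f

/-- Dualising exchanges injections and surjections, so the double dual of `R^n → N` is still onto;
reflexivity of `R^n` then passes to `N`. -/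
theorem Module.Dual.eval_surjective_of_isQuasiFrobenius (N : Type u) [AddCommGroup N]
    [Module R N] [Module.Finite R N] : Function.Surjective (Module.Dual.eval R N) := by
  obtain ⟨n, p, hp⟩ := Module.Finite.exists_fin' R N
  have h1 : Function.Surjective p.dualMap.dualMap :=
    LinearMap.dualMap_surjective_of_isQuasiFrobenius (LinearMap.dualMap_injective_of_surjective hp)
  intro y
  obtain ⟨w, rfl⟩ := h1 y
  obtain ⟨v, rfl⟩ := (Module.evalEquiv R (Fin n → R)).surjective w
  exact ⟨p v, rfl⟩

end QuasiFrobenius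

/-! ### The comparison `X^* ⊗ E → Hom(X, E)` -/

theorem dualTensorHom_naturality {R X Y E : Type u} [CommRing R] [AddCommGroup X] [Module R X]
    [AddCommGroup Y] [Module R Y] [AddCommGroup E] [Module R E] (i : X →ₗ[R] Y)
    (t : Module.Dual R Y ⊗[R] E) :
    dualTensorHom R X E (i.dualMap.rTensor E t) = dualTensorHom R Y E t ∘ₗ i := by
  induction t with
  | zero => simp
  | tmul f e => ext x; simp
  | add s t hs ht => simp only [map_add, hs, ht, LinearMap.add_comp]

theorem dualTensorHom_lTensor {R X E F : Type u} [CommRing R] [AddCommGroup X] [Module R X]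
    [AddCommGroup E] [Module R E] [AddCommGroup F] [Module R F] (h : E →ₗ[R] F)
    (t : Module.Dual R X ⊗[R] E) :
    dualTensorHom R X F (h.lTensor _ t) = h ∘ₗ dualTensorHom R X E t := by
  induction t with
  | zero => simp
  | tmul f e => ext x; simp
  | add s t hs ht => simp only [map_add, hs, ht, LinearMap.comp_add]

/-- Injectivity is inherited from a free cover `R^n → X`, since `X^* → (R^n)^*` stays injective
after tensoring with `E`. For surjectivity, a map from a finitely presented module to a flat one
factors through a finite free module. -/
theorem dualTensorHom_bijective_of_flat {R X E : Type u} [CommRing R] [IsNoetherianRing R]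
    [AddCommGroup X] [Module R X] [Module.Finite R X] [AddCommGroup E] [Module R E]
    [Module.Flat R E] : Function.Bijective (dualTensorHom R X E) := by
  constructor
  · obtain ⟨n, p, hp⟩ := Module.Finite.exists_fin' R X
    rw [injective_iff_map_eq_zero]
    intro t ht
    have h0 : dualTensorHom R (Fin n → R) E (p.dualMap.rTensor E t) = 0 := by
      rw [dualTensorHom_naturality, ht, LinearMap.zero_comp]
    have h1 : p.dualMap.rTensor E t = 0 := by
      apply (dualTensorHomEquiv R (Fin n → R) E).injective
      simpa using h0
    exact (injective_iff_map_eq_zero _).1 (Module.Flat.rTensor_preserves_injective_linearMap _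
      (LinearMap.dualMap_injective_of_surjective hp)) t h1
  · intro h
    have := Module.finitePresentation_of_finite R X
    obtain ⟨k, a, y, rfl⟩ := Module.Flat.exists_factorization_of_finitePresentation h
    obtain ⟨s, rfl⟩ := (dualTensorHomEquiv R (Fin k →₀ R) E).surjective y
    exact ⟨a.dualMap.rTensor E s, by rw [dualTensorHom_naturality]; simp⟩

namespace MeasuringPairing

/-! ### Rational actions -/

section Rational

variable {R A C : Type u} [CommRing R] [Ring A] [Algebra R A]
  [AddCommGroup C] [Module R C] [Coalgebra R C] (P : MeasuringPairing R A C)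

/-- A coalgebra in a measuring `α`-pairing is flat. -/
theorem flat_of_alphaCondition (hP : P.AlphaCondition) : Module.Flat R C := by
  rw [Module.Flat.iff_rTensor_preserves_injective_linearMap]
  intro N N' _ _ _ _ f hf
  rw [injective_iff_map_eq_zero]
  intro t ht
  -- `α` is natural and `Hom_R(A, -)` preserves injections.
  apply hP N
  ext a
  apply hf
  rw [← alpha_rTensor, ht]
  simp

/-- A family of endomorphisms `ρ a` of `X` indexed by `A` is rational if for every `x : X` the map
`a ↦ ρ a x` lies in the image of `X ⊗ C`. -/
def IsRationalAction {X : Type u} [AddCommGroup X] [Module R X] (ρ : A → Module.End R X) : Prop :=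
  ∀ x, ∃ t : X ⊗[R] C, ∀ a, P.alpha X t a = ρ a x

variable {P} {X Y : Type u} [AddCommGroup X] [Module R X] [AddCommGroup Y] [Module R Y]
  {ρ : A → Module.End R X}

/-- The tensor representing `a ↦ ρ a x` is unique by the α-condition, hence linear in `x`. -/
theorem IsRationalAction.exists_coaction (hP : P.AlphaCondition) (h : P.IsRationalAction ρ) :
    ∃ c : X →ₗ[R] X ⊗[R] C, ∀ x a, P.alpha X (c x) a = ρ a x := by
  choose c hc using h
  refine ⟨⟨⟨c, fun x y => hP X ?_⟩, fun r x => hP X ?_⟩, hc⟩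
  · ext a
    simp [hc]
  · ext a
    simp [hc]

/-- In `(Y / range i) ⊗ C` the image of `t` pairs to zero with all of `A`, so it vanishes by the
α-condition; right exactness does the rest. -/
theorem exists_rTensor_eq (hP : P.AlphaCondition) (i : X →ₗ[R] Y) (t : Y ⊗[R] C)
    (ht : ∀ a, P.alpha Y t a ∈ LinearMap.range i) : ∃ s : X ⊗[R] C, i.rTensor C s = t := by
  refine (rTensor_exact C (LinearMap.exact_map_mkQ_range i) (Submodule.mkQ_surjective _) t).1
    (hP _ ?_)
  ext a
  rw [alpha_rTensor, map_zero, LinearMap.zero_apply]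
  exact (Submodule.Quotient.mk_eq_zero _).2 (ht a)

theorem IsRationalAction.of_injective (hP : P.AlphaCondition) {ρ' : A → Module.End R Y}
    (h : P.IsRationalAction ρ') (i : X →ₗ[R] Y) (hi : Function.Injective i)
    (hc : ∀ a x, i (ρ a x) = ρ' a (i x)) : P.IsRationalAction ρ := by
  intro x
  obtain ⟨t, ht⟩ := h (i x)
  obtain ⟨s, rfl⟩ := exists_rTensor_eq hP i t fun a => ⟨ρ a x, by rw [ht, hc]⟩
  exact ⟨s, fun a => hi (by rw [hc, ← ht, alpha_rTensor])⟩

theorem form_lid_rTensor (f : Module.Dual R X) (t : X ⊗[R] C) (a : A) :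
    P.form a (TensorProduct.lid R C (f.rTensor C t)) = f (P.alpha X t a) := by
  induction t with
  | zero => simp
  | tmul x c => simp [mul_comm]
  | add s t hs ht => simp only [map_add, hs, ht, LinearMap.add_apply]

theorem alpha_dual_apply (s : Module.Dual R X ⊗[R] C) (a : A) (x : X) :
    P.alpha (Module.Dual R X) s a x = P.form a (dualTensorHom R X C s x) := by
  induction s with
  | zero => simp
  | tmul x c => simp [mul_comm]
  | add s t hs ht => simp only [map_add, hs, ht, LinearMap.add_apply]

/-- The dual of a finitely generated rational action is rational. -/
theorem IsRationalAction.dual [IsNoetherianRing R] [Module.Finite R X] (hP : P.AlphaCondition)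
    (h : P.IsRationalAction ρ) : P.IsRationalAction fun a => (ρ a).dualMap := by
  have := P.flat_of_alphaCondition hP
  obtain ⟨c, hc⟩ := h.exists_coaction hP
  intro f
  -- The map `x ↦ ∑ f(x₀) x₁` from `X` to `C` comes from a tensor in `X^* ⊗ C`, which represents the
  -- orbit map of `f`.
  obtain ⟨s, hs⟩ := (dualTensorHom_bijective_of_flat (R := R) (X := X) (E := C)).2
    ((TensorProduct.lid R C).toLinearMap ∘ₗ f.rTensor C ∘ₗ c)
  refine ⟨s, fun a => LinearMap.ext fun x => ?_⟩
  rw [alpha_dual_apply, hs]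
  simp only [LinearMap.comp_apply, LinearEquiv.coe_coe, form_lid_rTensor, hc]
  rfl

/-- Local finiteness: the first factors occurring in one tensor for `x` span the whole orbit. This
makes the reduction to finitely generated modules possible. -/
theorem IsRationalAction.exists_fg (h : P.IsRationalAction ρ) (x : X) :
    ∃ W : Submodule R X, W.FG ∧ ∀ a, ρ a x ∈ W := by
  classical
  obtain ⟨t, ht⟩ := h x
  obtain ⟨S, rfl⟩ := TensorProduct.exists_finset t
  refine ⟨Submodule.span R (S.image Prod.fst), ⟨_, rfl⟩, fun a => ?_⟩
  rw [← ht, map_sum, LinearMap.sum_apply]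
  refine Submodule.sum_mem _ fun p hp => ?_
  rw [alpha_tmul]
  exact Submodule.smul_mem _ _ (Submodule.subset_span (Finset.mem_image_of_mem _ hp))

theorem _root_.Submodule.finite_span_of_forall_exists_fg [IsNoetherianRing R] {A' : Type u}
    [Ring A'] [Algebra R A'] [Module A' X] [IsScalarTower R A' X]
    (h : ∀ x : X, ∃ W : Submodule R X, W.FG ∧ ∀ a : A', a • x ∈ W) (s : Finset X) :
    Module.Finite R (Submodule.span A' (s : Set X)) := by
  choose W hW hmem using h
  let N : Submodule R X := ⨆ x ∈ s, W x
  have hN : N.FG := Submodule.fg_biSup s W fun x _ => hW x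
  have hle : (Submodule.span A' (s : Set X)).restrictScalars R ≤ N := by
    intro x hx
    obtain ⟨f, -, rfl⟩ := Submodule.mem_span_finset.1 hx
    exact Submodule.sum_mem _ fun y hy =>
      (le_iSup₂ (f := fun x (_ : x ∈ s) => W x) y hy : W y ≤ N) (hmem y _)
  have : IsNoetherian R N := isNoetherian_of_fg_of_noetherian N hN
  exact Module.Finite.of_injective (Submodule.inclusion hle) (Submodule.inclusion_injective hle)

section LeftModule

variable [Module A X] [IsScalarTower R A X] [Module A Y] [IsScalarTower R A Y]

theorem isRational_iff : P.IsRational X ↔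
    P.IsRationalAction fun a => (Algebra.lsmul R R X a : Module.End R X) :=
  Submodule.eq_top_iff' (p := P.rat X)

theorem IsRational.submodule (hP : P.AlphaCondition) (h : P.IsRational X) (S : Submodule A X) :
    P.IsRational S :=
  isRational_iff.2 ((isRational_iff.1 h).of_injective hP (S.subtype.restrictScalars R)
    S.subtype_injective fun _ _ => rfl)

end LeftModule

section RightModule

variable [Module Aᵐᵒᵖ X] [IsScalarTower R Aᵐᵒᵖ X]

theorem isRightRational_iff : P.IsRightRational X ↔
    P.IsRationalAction fun a => (Algebra.lsmul R R X (MulOpposite.op a) : Module.End R X) := by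
  constructor
  · intro h x
    obtain ⟨t, ht⟩ := h x
    exact ⟨TensorProduct.comm R C X t, ht⟩
  · intro h x
    obtain ⟨t, ht⟩ := h x
    refine ⟨(TensorProduct.comm R C X).symm t, fun a => ?_⟩
    refine Eq.trans ?_ (ht a)
    simp [alphaRight]

theorem IsRightRational.submodule (hP : P.AlphaCondition) (h : P.IsRightRational X)
    (S : Submodule Aᵐᵒᵖ X) : P.IsRightRational S :=
  isRightRational_iff.2 ((isRightRational_iff.1 h).of_injective hP (S.subtype.restrictScalars R)
    S.subtype_injective fun _ _ => rfl)

end RightModule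

end Rational

/-! ### Balanced tensors -/

section Balanced

variable {R A C : Type u} [CommRing R] [Ring A] [Algebra R A]
  [AddCommGroup C] [Module R C] [Coalgebra R C] (P : MeasuringPairing R A C)

/-- A tensor in `M ⊗ E`, for a left `A`-module `M` and a left `C`-comodule `E`, is `A`-balanced if
the two actions of `A` on it agree. -/
def IsBalanced {M E : Type u} [AddCommGroup M] [Module R M] [Module A M] [IsScalarTower R A M]
    [AddCommGroup E] [Module R E] [LeftComodule R C E] (t : M ⊗[R] E) : Prop :=
  ∀ a : A, (Algebra.lsmul R R M a : Module.End R M).rTensor E t = (P.rightAct E a).lTensor M t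

/-- Balanced tensors lift along surjections of rational modules. -/
def LiftsBalanced (E : Type u) [AddCommGroup E] [Module R E] [LeftComodule R C E] : Prop :=
  ∀ (M K : Type u) [AddCommGroup M] [Module R M] [Module A M] [IsScalarTower R A M]
    [AddCommGroup K] [Module R K] [Module A K] [IsScalarTower R A K] (g : M →ₗ[A] K),
    P.IsRational M → P.IsRational K → Function.Surjective g →
    ∀ t : K ⊗[R] E, P.IsBalanced t →
      ∃ s : M ⊗[R] E, P.IsBalanced s ∧ (g.restrictScalars R).rTensor E s = t

variable {P}
variable {M K : Type u} [AddCommGroup M] [Module R M] [Module A M] [IsScalarTower R A M]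
  [AddCommGroup K] [Module R K] [Module A K] [IsScalarTower R A K]
  {E F : Type u} [AddCommGroup E] [Module R E] [LeftComodule R C E]
  [AddCommGroup F] [Module R F] [LeftComodule R C F]

theorem rTensor_lsmul_comm (g : M →ₗ[A] K) (a : A) (t : M ⊗[R] E) :
    (Algebra.lsmul R R K a : Module.End R K).rTensor E ((g.restrictScalars R).rTensor E t) =
      (g.restrictScalars R).rTensor E
        ((Algebra.lsmul R R M a : Module.End R M).rTensor E t) := by
  rw [← LinearMap.rTensor_comp_apply, ← LinearMap.rTensor_comp_apply]
  congr 2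
  ext m
  simp

theorem lTensor_rTensor_comm {M K E F : Type u} [AddCommGroup M] [Module R M] [AddCommGroup K]
    [Module R K] [AddCommGroup E] [Module R E] [AddCommGroup F] [Module R F] (g : M →ₗ[R] K)
    (h : E →ₗ[R] F) (t : M ⊗[R] E) :
    h.lTensor K (g.rTensor E t) = g.rTensor F (h.lTensor M t) := by
  rw [← LinearMap.comp_apply, ← LinearMap.comp_apply, LinearMap.lTensor_comp_rTensor,
    LinearMap.rTensor_comp_lTensor]

theorem IsBalanced.rTensor (g : M →ₗ[A] K) {t : M ⊗[R] E} (ht : P.IsBalanced t) :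
    P.IsBalanced ((g.restrictScalars R).rTensor E t) := fun a => by
  rw [rTensor_lsmul_comm, ht a, lTensor_rTensor_comm]

theorem IsBalanced.of_rTensor [Module.Flat R E] (g : M →ₗ[A] K) (hg : Function.Injective g)
    {t : M ⊗[R] E} (ht : P.IsBalanced ((g.restrictScalars R).rTensor E t)) :
    P.IsBalanced t := fun a => by
  apply Module.Flat.rTensor_preserves_injective_linearMap (M := E) (g.restrictScalars R) hg
  rw [← rTensor_lsmul_comm, ht a, lTensor_rTensor_comm]

theorem IsBalanced.lTensor (h : E →ₗ[R] F)
    (hh : ∀ a x, h (P.rightAct E a x) = P.rightAct F a (h x)) {t : M ⊗[R] E}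
    (ht : P.IsBalanced t) : P.IsBalanced (h.lTensor M t) := fun a => by
  rw [← lTensor_rTensor_comm, ht a, ← LinearMap.lTensor_comp_apply, ← LinearMap.lTensor_comp_apply]
  congr 2
  ext x
  exact hh a x

/-- Exactness in the middle for balanced tensors. -/
theorem IsBalanced.exists_of_exact [Module.Flat R E] {L : Type u} [AddCommGroup L] [Module R L]
    [Module A L] [IsScalarTower R A L] (f : L →ₗ[A] M) (g : M →ₗ[A] K)
    (hf : Function.Injective f) (hfg : Function.Exact f g) (hg : Function.Surjective g)
    {t : M ⊗[R] E} (ht : P.IsBalanced t) (h0 : (g.restrictScalars R).rTensor E t = 0) :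
    ∃ s : L ⊗[R] E, P.IsBalanced s ∧ (f.restrictScalars R).rTensor E s = t := by
  obtain ⟨s, rfl⟩ := (rTensor_exact E (f := f.restrictScalars R) (g := g.restrictScalars R)
    hfg hg t).1 h0
  exact ⟨s, ht.of_rTensor f hf, rfl⟩

end Balanced

end MeasuringPairing

namespace MeasuringPairing

/-! ### Rational modules and right comodules -/

section Comodule

variable {R A C : Type u} [CommRing R] [Ring A] [Algebra R A]
  [AddCommGroup C] [Module R C] [Coalgebra R C] (P : MeasuringPairing R A C)

/-- A left `A`-module structure and a right `C`-comodule structure on `M` are compatible if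
`a m = ∑ m₀ ⟨a, m₁⟩`. -/
def IsCompatible (M : Type u) [AddCommGroup M] [Module R M] [Module A M] [RightComodule R C M] :
    Prop :=
  ∀ (m : M) (a : A), P.alpha M (RightComodule.coact (R := R) (C := C) m) a = a • m

/-- Evaluation of the middle factor of `M ⊗ C ⊗ E` at `a`. -/
noncomputable def evalMiddle (M E : Type u) [AddCommGroup M] [Module R M] [AddCommGroup E]
    [Module R E] (a : A) : M ⊗[R] (C ⊗[R] E) →ₗ[R] M ⊗[R] E :=
  ((TensorProduct.lid R E).toLinearMap ∘ₗ (P.form a).rTensor E).lTensor M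

variable {P}

theorem evalMiddle_eq_alpha {M E : Type u} [AddCommGroup M] [Module R M] [AddCommGroup E]
    [Module R E] (a : A) (z : M ⊗[R] (C ⊗[R] E)) :
    P.evalMiddle M E a z = P.alpha (M ⊗[R] E) ((TensorProduct.assoc R M E C).symm
      ((TensorProduct.comm R C E).toLinearMap.lTensor M z)) a := by
  have h : P.evalMiddle M E a = LinearMap.applyₗ a ∘ₗ P.alpha (M ⊗[R] E) ∘ₗ
      (TensorProduct.assoc R M E C).symm.toLinearMap ∘ₗ
        (TensorProduct.comm R C E).toLinearMap.lTensor M := by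
    ext m c e
    simp [evalMiddle]
  exact LinearMap.congr_fun h z

/-- With `C` moved to the last place, these evaluations are the values of `α` on `M ⊗ E`. Comodule
identities can thus be tested on `A`-actions. -/
theorem ext_evalMiddle (hP : P.AlphaCondition) {M E : Type u} [AddCommGroup M] [Module R M]
    [AddCommGroup E] [Module R E] {z w : M ⊗[R] (C ⊗[R] E)}
    (h : ∀ a, P.evalMiddle M E a z = P.evalMiddle M E a w) : z = w := by
  have h1 : P.alpha (M ⊗[R] E) ((TensorProduct.assoc R M E C).symm
      ((TensorProduct.comm R C E).toLinearMap.lTensor M z)) = P.alpha (M ⊗[R] E)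
        ((TensorProduct.assoc R M E C).symm
          ((TensorProduct.comm R C E).toLinearMap.lTensor M w)) := by
    ext a
    rw [← evalMiddle_eq_alpha, ← evalMiddle_eq_alpha, h]
  exact (TensorProduct.congr (LinearEquiv.refl R M) (TensorProduct.comm R C E)).injective
    ((TensorProduct.assoc R M E C).symm.injective (hP _ h1))

theorem evalMiddle_assoc {M N E : Type u} [AddCommGroup M] [Module R M]
    [AddCommGroup N] [Module R N] [AddCommGroup E] [Module R E]
    (c : N →ₗ[R] M ⊗[R] C) (a : A) (t : N ⊗[R] E) :
    P.evalMiddle M E a (TensorProduct.assoc R M C E (c.rTensor E t)) =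
      ((LinearMap.applyₗ a ∘ₗ P.alpha M) ∘ₗ c).rTensor E t := by
  have h : P.evalMiddle M E a ∘ₗ (TensorProduct.assoc R M C E).toLinearMap =
      (LinearMap.applyₗ a ∘ₗ P.alpha M).rTensor E := by
    ext m c e
    simp [evalMiddle, TensorProduct.smul_tmul']
  rw [LinearMap.rTensor_comp_apply]
  exact LinearMap.congr_fun h _

theorem evalMiddle_coact {M E : Type u} [AddCommGroup M] [Module R M]
    [AddCommGroup E] [Module R E] [LeftComodule R C E] (a : A) (t : M ⊗[R] E) :
    P.evalMiddle M E a ((LeftComodule.coact (R := R) (C := C) (M := E)).lTensor M t) =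
      (P.rightAct E a).lTensor M t := by
  rw [evalMiddle, ← LinearMap.lTensor_comp_apply]
  rfl

/-- This is `⟨ab, c⟩ = ∑ ⟨a, c₁⟩⟨b, c₂⟩` with coefficients in `M`; it translates between
coassociativity and associativity of the action. -/
theorem alpha_mul {M : Type u} [AddCommGroup M] [Module R M] (a b : A) (t : M ⊗[R] C) :
    P.alpha M t (a * b) = P.alpha M (P.alpha (M ⊗[R] C) ((TensorProduct.assoc R M C C).symm
      ((Coalgebra.comul (R := R) (A := C)).lTensor M t)) b) a := by
  induction t with
  | zero => simp
  | add x y hx hy => simp only [map_add, LinearMap.add_apply, hx, hy]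
  | tmul m c =>
    rw [alpha_tmul, form_mul, LinearMap.lTensor_tmul]
    simp only [LinearMap.comp_apply]
    generalize Coalgebra.comul (R := R) c = z
    induction z with
    | zero => simp
    | tmul x y => simp [smul_smul, mul_comm]
    | add x y hx hy => simp only [map_add, add_smul, TensorProduct.tmul_add,
        LinearMap.add_apply, hx, hy]

theorem alpha_one {M : Type u} [AddCommGroup M] [Module R M] (t : M ⊗[R] C) :
    P.alpha M t 1 =
      TensorProduct.rid R M ((Coalgebra.counit (R := R) (A := C)).lTensor M t) := by
  induction t with
  | zero => simp
  | tmul m c => simp [form_one]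
  | add x y hx hy => simp only [map_add, LinearMap.add_apply, hx, hy]

section OfComodule

variable (P) (M : Type u) [AddCommGroup M] [Module R M] [RightComodule R C M]

/-- The left `A`-module structure `a m = ∑ m₀ ⟨a, m₁⟩` on a right `C`-comodule. -/
@[reducible] noncomputable def leftModuleOfComodule : Module A M where
  smul a m := P.alpha M (RightComodule.coact (R := R) (C := C) m) a
  one_smul m := by
    change P.alpha M _ 1 = m
    rw [alpha_one]
    exact LinearMap.congr_fun (RightComodule.counital (R := R) (C := C) (M := M)) m
  mul_smul a b m := by
    change P.alpha M _ (a * b) = P.alpha M (RightComodule.coact (P.alpha M _ b)) a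
    have h := LinearMap.congr_fun (RightComodule.coassoc (R := R) (C := C) (M := M)) m
    simp only [LinearMap.comp_apply, LinearEquiv.coe_coe] at h
    rw [alpha_mul, ← h, LinearEquiv.symm_apply_apply, alpha_rTensor]
  smul_zero a := by
    change P.alpha M (RightComodule.coact 0) a = 0
    simp
  smul_add a x y := by
    change P.alpha M (RightComodule.coact (x + y)) a = _
    simp only [map_add]
    rfl
  add_smul a b _ := map_add (P.alpha M _) a b
  zero_smul _ := map_zero (P.alpha M _)

theorem isScalarTower_leftModuleOfComodule :
    letI := P.leftModuleOfComodule M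
    IsScalarTower R A M :=
  letI := P.leftModuleOfComodule M
  ⟨fun r a _ => map_smul (P.alpha M _) r a⟩

theorem isCompatible_leftModuleOfComodule :
    letI := P.leftModuleOfComodule M
    P.IsCompatible M :=
  fun _ _ => rfl

end OfComodule

section OfModule

variable {M : Type u} [AddCommGroup M] [Module R M] [Module A M] [IsScalarTower R A M]

/-- The right `C`-comodule structure on a rational left `A`-module. -/
theorem IsRational.exists_rightComodule (hP : P.AlphaCondition) (h : P.IsRational M) :
    ∃ _ : RightComodule R C M, P.IsCompatible M := by
  obtain ⟨c, hc⟩ := (isRational_iff.1 h).exists_coaction hP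
  refine ⟨⟨c, ?_, ?_⟩, hc⟩
  · ext m
    simp only [LinearMap.comp_apply, LinearEquiv.coe_coe]
    rw [← LinearEquiv.eq_symm_apply]
    -- The identity lives in `(M ⊗ C) ⊗ C`; testing it through `α` once for each factor `C` reduces
    -- it to `(ab)m = a(bm)`.
    apply hP
    ext b
    apply hP
    ext a
    rw [← alpha_mul, alpha_rTensor]
    simp [hc]
  · ext m
    simp only [LinearMap.comp_apply, LinearEquiv.coe_coe]
    rw [← alpha_one (P := P), hc]
    simp

end OfModule

section Compatible

variable {M N : Type u} [AddCommGroup M] [Module R M] [Module A M] [IsScalarTower R A M]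
  [RightComodule R C M] [AddCommGroup N] [Module R N] [Module A N] [IsScalarTower R A N]
  [RightComodule R C N]

theorem IsCompatible.isRational (hM : P.IsCompatible M) : P.IsRational M :=
  isRational_iff.2 fun m => ⟨_, hM m⟩

/-- Evaluating the middle factor at `a` turns the two coactions into the actions of `a` on `M` and
on `E`, and these evaluations separate tensors. -/
theorem mem_cotensor_iff_isBalanced (hP : P.AlphaCondition) (hM : P.IsCompatible M) {E : Type u}
    [AddCommGroup E] [Module R E] [LeftComodule R C E] (t : M ⊗[R] E) :
    t ∈ Cotensor R C M E ↔ P.IsBalanced t := by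
  have h : ∀ a, P.evalMiddle M E a (TensorProduct.assoc R M C E
      ((RightComodule.coact (R := R) (C := C) (M := M)).rTensor E t)) =
      (Algebra.lsmul R R M a : Module.End R M).rTensor E t := by
    intro a
    rw [evalMiddle_assoc]
    congr 2
    ext m
    exact hM m a
  simp only [Cotensor, LinearMap.mem_ker, LinearMap.sub_apply, LinearMap.comp_apply,
    LinearEquiv.coe_coe, sub_eq_zero, IsBalanced]
  constructor
  · intro ht a
    rw [← h, ht, evalMiddle_coact]
  · intro ht
    refine ext_evalMiddle hP fun a => ?_
    rw [h, ht, evalMiddle_coact]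

theorem isColinear_of_linear (hP : P.AlphaCondition) (hM : P.IsCompatible M)
    (hN : P.IsCompatible N) (g : M →ₗ[A] N) :
    RightComodule.IsColinear C (g.restrictScalars R) := by
  ext m
  apply hP
  ext a
  simp only [LinearMap.comp_apply]
  rw [alpha_rTensor, hM, hN]
  simp

end Compatible

theorem smul_of_isColinear {M N : Type u} [AddCommGroup M] [Module R M] [Module A M]
    [RightComodule R C M] [AddCommGroup N] [Module R N] [Module A N] [RightComodule R C N]
    (hM : P.IsCompatible M) (hN : P.IsCompatible N) (g : M →ₗ[R] N) (hg : RightComodule.IsColinear C g) (a : A) (m : M) : g (a • m) = a • g m := by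
  have h := LinearMap.congr_fun hg m
  simp only [LinearMap.comp_apply] at h
  rw [← hM, ← hN, h, alpha_rTensor]

/-- A flat left comodule is coflat if and only if balanced tensors with it lift along surjections
of rational modules. -/
theorem isCoflat_iff_liftsBalanced (hP : P.AlphaCondition) {E : Type u} [AddCommGroup E]
    [Module R E] [LeftComodule R C E] [Module.Flat R E] :
    LeftComodule.IsCoflat R C E ↔ P.LiftsBalanced E := by
  constructor
  · intro h M K _ _ _ _ _ _ _ _ g hM hK hg t ht
    -- The kernel only serves to complete `g` to a short exact sequence of comodules.
    let L : Submodule A M := LinearMap.ker g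
    obtain ⟨_, hLc⟩ := (hM.submodule hP L).exists_rightComodule hP
    obtain ⟨_, hMc⟩ := hM.exists_rightComodule hP
    obtain ⟨_, hKc⟩ := hK.exists_rightComodule hP
    obtain ⟨-, -, hs⟩ := h L M K (L.subtype.restrictScalars R) (g.restrictScalars R)
      (isColinear_of_linear hP hLc hMc _) (isColinear_of_linear hP hMc hKc _)
      L.subtype_injective (LinearMap.exact_subtype_ker_map g) hg
    obtain ⟨⟨s, hs1⟩, hs2⟩ := hs ⟨t, (mem_cotensor_iff_isBalanced hP hKc t).2 ht⟩
    exact ⟨s, (mem_cotensor_iff_isBalanced hP hMc s).1 hs1, congrArg Subtype.val hs2⟩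
  · intro h L M K _ _ _ _ _ _ _ _ _ f g hf hg hfi hfg hgs
    let _ := P.leftModuleOfComodule L
    let _ := P.leftModuleOfComodule M
    let _ := P.leftModuleOfComodule K
    have := P.isScalarTower_leftModuleOfComodule L
    have := P.isScalarTower_leftModuleOfComodule M
    have := P.isScalarTower_leftModuleOfComodule K
    have hLc := P.isCompatible_leftModuleOfComodule L
    have hMc := P.isCompatible_leftModuleOfComodule M
    have hKc := P.isCompatible_leftModuleOfComodule K
    let f' : L →ₗ[A] M := { f with map_smul' := smul_of_isColinear hLc hMc f hf }
    let g' : M →ₗ[A] K := { g with map_smul' := smul_of_isColinear hMc hKc g hg }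
    -- Injectivity and middle exactness follow from flatness; only the last goal uses the lifting
    -- hypothesis.
    refine ⟨fun x y hxy => ?_, fun x => ⟨fun hx => ?_, ?_⟩, fun y => ?_⟩
    · exact Subtype.ext (Module.Flat.rTensor_preserves_injective_linearMap f hfi
        (congrArg Subtype.val hxy))
    · obtain ⟨s, hs1, hs2⟩ := ((mem_cotensor_iff_isBalanced hP hMc x.1).1 x.2).exists_of_exact
        f' g' hfi hfg hgs (congrArg Subtype.val hx)
      exact ⟨⟨s, (mem_cotensor_iff_isBalanced hP hLc s).2 hs1⟩, Subtype.ext hs2⟩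
    · rintro ⟨z, rfl⟩
      refine Subtype.ext ?_
      change g.rTensor E (f.rTensor E z.1) = 0
      rw [← LinearMap.rTensor_comp_apply, hfg.linearMap_comp_eq_zero, LinearMap.rTensor_zero]
      rfl
    · obtain ⟨s, hs1, hs2⟩ := h M K g' hMc.isRational hKc.isRational hgs y.1
        ((mem_cotensor_iff_isBalanced hP hKc y.1).1 y.2)
      exact ⟨⟨s, (mem_cotensor_iff_isBalanced hP hMc s).2 hs1⟩, Subtype.ext hs2⟩

end Comodule

end MeasuringPairing

namespace MeasuringPairing

/-! ### Coinduction and balanced tensors -/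

section Coinduction

variable {R A B C D : Type u} [CommRing R] [Ring A] [Algebra R A] [Ring B] [Algebra R B]
  [AddCommGroup C] [Module R C] [Coalgebra R C] [AddCommGroup D] [Module R D] [Coalgebra R D]
  {P : MeasuringPairing R A C} {Q : MeasuringPairing R B D}

theorem rightAct_corestrict (φ : Hom Q P) (M : Type u) [AddCommGroup M] [Module R M]
    [LeftComodule R D M] (a : A) :
    P.rightAct (Corestrict φ.θ M) a = Q.rightAct M (φ.ξ a) := by
  change (TensorProduct.lid R M).toLinearMap ∘ₗ (P.form a).rTensor M ∘ₗ
    (φ.θ.toLinearMap.rTensor M ∘ₗ LeftComodule.coact (R := R) (C := D) (M := M)) = _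
  have h : Q.form (φ.ξ a) = P.form a ∘ₗ φ.θ.toLinearMap := LinearMap.ext (φ.form_eq a)
  rw [rightAct, h, LinearMap.rTensor_comp, LinearMap.comp_assoc]

theorem form_rightAct_self (b c : B) (d : D) :
    Q.form c (Q.rightAct D b d) = Q.form (b * c) d := by
  rw [form_mul, rightAct]
  simp only [LinearMap.comp_apply]
  change Q.form c (TensorProduct.lid R D ((Q.form b).rTensor D (Coalgebra.comul d))) = _
  generalize Coalgebra.comul (R := R) d = z
  induction z with
  | zero => simp
  | tmul x y => simp
  | add x y hx hy => simp only [map_add, hx, hy]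

variable {M K : Type u} [AddCommGroup M] [Module R M] [Module A M] [IsScalarTower R A M]
  [AddCommGroup K] [Module R K] [Module A K] [IsScalarTower R A K]

theorem alpha_rightAct_self (b c : B) (t : M ⊗[R] D) :
    Q.alpha M ((Q.rightAct D b).lTensor M t) c = Q.alpha M t (b * c) := by
  induction t with
  | zero => simp
  | tmul m d => simp [form_rightAct_self]
  | add x y hx hy => simp only [map_add, LinearMap.add_apply, hx, hy]

variable (φ : Hom Q P)

/-- Since `α` is injective and natural, `f(ξ(a) b) = a f(b)` for all `b` is an equality of tensors.
-/
theorem alpha_mem_homOverSubmodule_iff (hQ : Q.AlphaCondition) (t : M ⊗[R] D) :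
    Q.alpha M t ∈ homOverSubmodule φ.ξ M ↔ ∀ a,
      (Algebra.lsmul R R M a : Module.End R M).rTensor D t =
        (Q.rightAct D (φ.ξ a)).lTensor M t := by
  refine forall_congr' fun a => ?_
  rw [← (hQ M).eq_iff, LinearMap.ext_iff]
  refine forall_congr' fun b => ?_
  rw [alpha_rTensor, alpha_rightAct_self, eq_comm]
  rfl

theorem isBalanced_corestrict_iff (hQ : Q.AlphaCondition) (t : M ⊗[R] Corestrict φ.θ D) :
    P.IsBalanced t ↔ Q.alpha M t ∈ homOverSubmodule φ.ξ M := by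
  refine Iff.trans (forall_congr' fun a => ?_) (alpha_mem_homOverSubmodule_iff φ hQ t).symm
  rw [rightAct_corestrict]
  rfl

/-- Rationality of `f` is defined by a tensor in `Hom_A(B, M) ⊗ D` depending on the orbit of `f`;
this replaces it by a tensor in `M ⊗ D` representing `f` itself. -/
theorem mem_coind_iff (hQ : Q.AlphaCondition) (f : HomOver φ.ξ M) :
    f ∈ Coind φ M ↔ ∃ t : M ⊗[R] D, Q.alpha M t = f.1 := by
  constructor
  · rintro ⟨s, hs⟩
    -- Evaluation at `1` recovers `f`, as `(b f)(1) = f(b)`.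
    let ev : HomOver φ.ξ M →ₗ[R] M :=
      LinearMap.applyₗ (1 : B) ∘ₗ (homOverSubmodule φ.ξ M).subtype
    refine ⟨ev.rTensor D s, LinearMap.ext fun b => ?_⟩
    rw [alpha_rTensor, hs]
    exact congrArg f.1 (one_mul b)
  · rintro ⟨t, ht⟩
    let i : HomOver φ.ξ M →ₗ[R] (B →ₗ[R] M) := (homOverSubmodule φ.ξ M).subtype
    -- Comultiplying `t` represents `b ↦ b f` with values in `Hom_R(B, M)`; these values are
    -- `A`-linear, so `exists_rTensor_eq` pulls `u` back.
    let u : (B →ₗ[R] M) ⊗[R] D := (Q.alpha M).rTensor D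
      ((TensorProduct.assoc R M D D).symm ((Coalgebra.comul (R := R) (A := D)).lTensor M t))
    have hu : ∀ b, Q.alpha _ u b = i (b • f) := by
      intro b
      ext x
      rw [alpha_rTensor, ← alpha_mul, ht]
      rfl
    obtain ⟨s, hs⟩ := exists_rTensor_eq hQ i u fun b => ⟨_, (hu b).symm⟩
    refine ⟨s, fun b => Subtype.ext ((Q.alpha_rTensor i b s).symm.trans ?_)⟩
    rw [hs]
    exact hu b

/-- Coinduction is exact if and only if balanced tensors with `D` lift along surjections of
rational modules. -/
theorem isExact_coind_iff_liftsBalanced (hP : P.AlphaCondition) (hQ : Q.AlphaCondition) :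
    Coind.IsExact φ ↔ P.LiftsBalanced (Corestrict φ.θ D) := by
  have : Module.Flat R (Corestrict φ.θ D) := Q.flat_of_alphaCondition hQ
  constructor
  · intro h M K _ _ _ _ _ _ _ _ g hM hK hg t ht
    obtain ⟨-, -, hs⟩ := h (LinearMap.ker g) M K (LinearMap.ker g).subtype g
      (hM.submodule hP _) hM hK (Submodule.subtype_injective _)
      (LinearMap.exact_subtype_ker_map g) hg
    have hmem := (isBalanced_corestrict_iff φ hQ t).1 ht
    obtain ⟨⟨f, hf⟩, hfg⟩ := hs ⟨⟨Q.alpha K t, hmem⟩, (mem_coind_iff φ hQ _).2 ⟨t, rfl⟩⟩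
    obtain ⟨s, hsf⟩ := (mem_coind_iff φ hQ f).1 hf
    refine ⟨s, (isBalanced_corestrict_iff φ hQ s).2 (hsf ▸ f.2), hQ K ?_⟩
    ext b
    refine (Q.alpha_rTensor (g.restrictScalars R) b s).trans ?_
    rw [hsf]
    exact LinearMap.congr_fun (congrArg (fun z => z.1.1) hfg) b
  · intro h L M K _ _ _ _ _ _ _ _ _ _ _ _ f g hL hM hK hf hfg hg
    refine ⟨fun x y hxy => ?_, fun x => ⟨fun hx => ?_, ?_⟩, fun y => ?_⟩
    · refine Subtype.ext (Subtype.ext (LinearMap.ext fun b => hf ?_))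
      exact LinearMap.congr_fun (congrArg (fun z => z.1.1) hxy) b
    · obtain ⟨t, ht⟩ := (mem_coind_iff φ hQ x.1).1 x.2
      have hb := (isBalanced_corestrict_iff φ hQ t).2 (ht ▸ x.1.2)
      have h0 : (g.restrictScalars R).rTensor (Corestrict φ.θ D) t = 0 := by
        apply hQ K
        ext b
        refine (Q.alpha_rTensor (g.restrictScalars R) b t).trans ?_
        rw [ht]
        refine Eq.trans ?_ (LinearMap.congr_fun (map_zero (Q.alpha K)) b).symm
        exact LinearMap.congr_fun (congrArg (fun z => z.1.1) hx) b
      obtain ⟨s, hs1, hs2⟩ := hb.exists_of_exact f g hf hfg hg h0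
      refine ⟨⟨⟨Q.alpha L s, (isBalanced_corestrict_iff φ hQ s).1 hs1⟩,
        (mem_coind_iff φ hQ _).2 ⟨s, rfl⟩⟩, ?_⟩
      refine Subtype.ext (Subtype.ext (LinearMap.ext fun b => ?_))
      rw [← ht, ← hs2]
      exact (Q.alpha_rTensor (f.restrictScalars R) b s).symm
    · rintro ⟨z, rfl⟩
      exact Subtype.ext (Subtype.ext (LinearMap.ext fun b => hfg.apply_apply_eq_zero _))
    · obtain ⟨t, ht⟩ := (mem_coind_iff φ hQ y.1).1 y.2
      obtain ⟨s, hs1, hs2⟩ := h M K g hM hK hg t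
        ((isBalanced_corestrict_iff φ hQ t).2 (ht ▸ y.1.2))
      refine ⟨⟨⟨Q.alpha M s, (isBalanced_corestrict_iff φ hQ s).1 hs1⟩,
        (mem_coind_iff φ hQ _).2 ⟨s, rfl⟩⟩, ?_⟩
      refine Subtype.ext (Subtype.ext (LinearMap.ext fun b => ?_))
      rw [← ht, ← hs2]
      exact (Q.alpha_rTensor (g.restrictScalars R) b s).symm

end Coinduction

end MeasuringPairing

/-- An extension problem is solvable as soon as it is solvable along the submodules of cyclic
submodules. -/
theorem LinearMap.exists_extension_of_forall_span_singleton {S X Y E : Type u} [Ring S]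
    [AddCommGroup X] [Module S X] [AddCommGroup Y] [Module S Y] [AddCommGroup E] [Module S E]
    (i : X →ₗ[S] Y) (hi : Function.Injective i) (f : X →ₗ[S] E)
    (h : ∀ (y : Y) (W : Submodule S (Submodule.span S {y})) (k : W →ₗ[S] E),
      ∃ k' : Submodule.span S {y} →ₗ[S] E, k' ∘ₗ W.subtype = k) :
    ∃ g : Y →ₗ[S] E, g ∘ₗ i = f := by
  have : Fact (Function.Injective i) := ⟨hi⟩
  let e := Module.Baer.extensionOfMax i f
  have htop : ∀ y, y ∈ e.domain := by
    intro y
    -- `W` is the part of the cyclic module on which the maximal extension is already defined.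
    -- Extending from `W` and gluing gives an extension defined at `y`, so maximality puts `y` in
    -- the domain.
    let W : Submodule S (Submodule.span S {y}) :=
      e.domain.comap (Submodule.span S {y}).subtype
    let r : W →ₗ[S] e.domain := (Submodule.span S {y}).subtype.restrict (fun _ hw => hw)
    obtain ⟨k', hk'⟩ := h y W (e.toFun ∘ₗ r)
    let p : Y →ₗ.[S] E := ⟨Submodule.span S {y}, k'⟩
    have hp : ∀ (x : e.domain) (z : p.domain), (x : Y) = z → e.toLinearPMap x = p z := by
      rintro ⟨x, hx⟩ ⟨z, hz⟩ rfl
      exact (LinearMap.congr_fun hk' ⟨⟨x, hz⟩, hx⟩).symm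
    have hle := LinearPMap.left_le_sup e.toLinearPMap p hp
    let e' : Module.Baer.ExtensionOf i f :=
      { e.toLinearPMap.sup p hp with
        le := e.le.trans hle.1
        is_extension := fun m => (e.is_extension m).trans (hle.2 rfl) }
    have heq : e' = e := Module.Baer.extensionOfMax_is_max i f e' hle
    rw [← heq]
    exact (LinearPMap.right_le_sup e.toLinearPMap p hp).1 (Submodule.mem_span_singleton_self y)
  refine ⟨e.toFun ∘ₗ LinearMap.id.codRestrict e.domain htop, LinearMap.ext fun x => ?_⟩
  exact (e.is_extension x).symm

namespace MeasuringPairing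

/-! ### Duals of modules and the lifting of balanced tensors -/

section DualModule

variable (R : Type u) {A : Type u} [CommRing R] [Ring A] [Algebra R A]

/-- The dual of a right `A`-module as a left `A`-module. -/
@[reducible] noncomputable def dualLeftModule (X : Type u) [AddCommGroup X] [Module R X]
    [Module Aᵐᵒᵖ X] [IsScalarTower R Aᵐᵒᵖ X] : Module A (Module.Dual R X) where
  smul a f := f ∘ₗ (Algebra.lsmul R R X (MulOpposite.op a) : Module.End R X)
  one_smul f := LinearMap.ext fun x => congrArg f (one_smul Aᵐᵒᵖ x)
  mul_smul a b f := LinearMap.ext fun x =>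
    congrArg f (mul_smul (MulOpposite.op b) (MulOpposite.op a) x)
  smul_zero _ := rfl
  smul_add _ _ _ := rfl
  add_smul a b f := LinearMap.ext fun x =>
    (congrArg f (add_smul (MulOpposite.op a) (MulOpposite.op b) x)).trans (f.map_add _ _)
  zero_smul f := LinearMap.ext fun x =>
    (congrArg f (zero_smul Aᵐᵒᵖ x)).trans f.map_zero

theorem isScalarTower_dualLeftModule (X : Type u) [AddCommGroup X] [Module R X]
    [Module Aᵐᵒᵖ X] [IsScalarTower R Aᵐᵒᵖ X] :
    letI := dualLeftModule (A := A) R X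
    IsScalarTower R A (Module.Dual R X) :=
  letI := dualLeftModule (A := A) R X
  ⟨fun r a f => LinearMap.ext fun x =>
    (congrArg f (smul_assoc r (MulOpposite.op a) x)).trans (f.map_smul r _)⟩

/-- The dual of a left `A`-module as a right `A`-module. -/
@[reducible] noncomputable def dualRightModule (X : Type u) [AddCommGroup X] [Module R X]
    [Module A X] [IsScalarTower R A X] : Module Aᵐᵒᵖ (Module.Dual R X) where
  smul a f := f ∘ₗ (Algebra.lsmul R R X a.unop : Module.End R X)
  one_smul f := LinearMap.ext fun x => congrArg f (one_smul A x)
  mul_smul a b f := LinearMap.ext fun x => congrArg f (mul_smul b.unop a.unop x)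
  smul_zero _ := rfl
  smul_add _ _ _ := rfl
  add_smul a b f := LinearMap.ext fun x =>
    (congrArg f (add_smul a.unop b.unop x)).trans (f.map_add _ _)
  zero_smul f := LinearMap.ext fun x => (congrArg f (zero_smul A x)).trans f.map_zero

theorem isScalarTower_dualRightModule (X : Type u) [AddCommGroup X] [Module R X]
    [Module A X] [IsScalarTower R A X] :
    letI := dualRightModule (A := A) R X
    IsScalarTower R Aᵐᵒᵖ (Module.Dual R X) :=
  letI := dualRightModule (A := A) R X
  ⟨fun r a f => LinearMap.ext fun x =>
    (congrArg f (smul_assoc r a.unop x)).trans (f.map_smul r _)⟩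

end DualModule

section Injective

variable {R A C : Type u} [CommRing R] [Ring A] [Algebra R A]
  [AddCommGroup C] [Module R C] [Coalgebra R C] {P : MeasuringPairing R A C}
  {E : Type u} [AddCommGroup E] [Module R E] [LeftComodule R C E]

theorem isRightRational_rightModuleOf : P.IsRightRational (P.RightModuleOf E) := by
  refine isRightRational_iff.2 fun x =>
    ⟨TensorProduct.comm R C E (LeftComodule.coact (R := R) (C := C) (M := E) x), fun a => ?_⟩
  change P.alpha E _ a = TensorProduct.lid R E ((P.form a).rTensor E
    (LeftComodule.coact (R := R) (C := C) (M := E) x))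
  generalize LeftComodule.coact (R := R) (C := C) (M := E) x = z
  induction z with
  | zero => simp
  | tmul c e => simp
  | add s t hs ht => simp only [map_add, LinearMap.add_apply, hs, ht]

/-- Inside `Hom(X, E)` the two actions are precomposition with `a` on `X` and postcomposition with
`a` on `E`. -/
theorem isBalanced_dual_iff {X : Type u} [AddCommGroup X] [Module R X] [Module Aᵐᵒᵖ X]
    [IsScalarTower R Aᵐᵒᵖ X] (hinj : Function.Injective (dualTensorHom R X E))
    (t : Module.Dual R X ⊗[R] E) :
    letI := dualLeftModule (A := A) R X
    letI := isScalarTower_dualLeftModule (A := A) R X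
    P.IsBalanced t ↔ ∀ (a : A) (x : X),
      dualTensorHom R X E t (MulOpposite.op a • x) = P.rightAct E a (dualTensorHom R X E t x) := by
  let _ := dualLeftModule (A := A) R X
  let _ := isScalarTower_dualLeftModule (A := A) R X
  refine forall_congr' fun a => ?_
  have h : (Algebra.lsmul R R (Module.Dual R X) a : Module.End R (Module.Dual R X)) =
    (Algebra.lsmul R R X (MulOpposite.op a) : Module.End R X).dualMap := rfl
  rw [← hinj.eq_iff, LinearMap.ext_iff, h, dualTensorHom_naturality, dualTensorHom_lTensor]
  rfl

/-- The map `N ⊗ E → Hom(N^*, E)`, `n ⊗ e ↦ [f ↦ f(n) e]`. -/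
noncomputable def evalTensorHom (R N E : Type u) [CommRing R] [AddCommGroup N] [Module R N]
    [AddCommGroup E] [Module R E] : N ⊗[R] E →ₗ[R] (Module.Dual R N →ₗ[R] E) :=
  dualTensorHom R (Module.Dual R N) E ∘ₗ (Module.Dual.eval R N).rTensor E

theorem evalTensorHom_rTensor {M N E : Type u} [AddCommGroup M] [Module R M] [AddCommGroup N]
    [Module R N] [AddCommGroup E] [Module R E] (g : M →ₗ[R] N) (t : M ⊗[R] E) :
    evalTensorHom R N E (g.rTensor E t) = evalTensorHom R M E t ∘ₗ g.dualMap := by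
  induction t with
  | zero => simp
  | tmul m e => ext f; simp [evalTensorHom]
  | add s t hs ht => simp only [map_add, hs, ht, LinearMap.add_comp]

theorem evalTensorHom_lTensor {N E F : Type u} [AddCommGroup N]
    [Module R N] [AddCommGroup E] [Module R E] [AddCommGroup F] [Module R F] (h : E →ₗ[R] F)
    (t : N ⊗[R] E) :
    evalTensorHom R N F (h.lTensor N t) = h ∘ₗ evalTensorHom R N E t := by
  induction t with
  | zero => simp
  | tmul m e => ext f; simp [evalTensorHom]
  | add s t hs ht => simp only [map_add, hs, ht, LinearMap.comp_add]

/-- The counterpart of `isBalanced_dual_iff` with `N` in the role of `X^*`; it turns lifting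
problems into extension problems on duals. -/
theorem isBalanced_iff_evalTensorHom {N : Type u} [AddCommGroup N] [Module R N] [Module A N]
    [IsScalarTower R A N] (hinj : Function.Injective (evalTensorHom R N E)) (t : N ⊗[R] E) :
    letI := dualRightModule (A := A) R N
    P.IsBalanced t ↔ ∀ (a : A) (f : Module.Dual R N),
      evalTensorHom R N E t (MulOpposite.op a • f) =
        P.rightAct E a (evalTensorHom R N E t f) := by
  refine forall_congr' fun a => ?_
  rw [← hinj.eq_iff, LinearMap.ext_iff, evalTensorHom_rTensor, evalTensorHom_lTensor]
  rfl

variable [IsQuasiFrobenius R]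

/-- Reflexivity gives `N ⊗ E ≃ N^** ⊗ E`, and `N^*` is again finitely generated because it embeds in
some `(R^n)^*`. -/
theorem evalTensorHom_bijective (N E : Type u) [AddCommGroup N] [Module R N] [Module.Finite R N]
    [AddCommGroup E] [Module R E] [Module.Flat R E] :
    Function.Bijective (evalTensorHom R N E) := by
  have : Module.Finite R (Module.Dual R N) := by
    obtain ⟨n, p, hp⟩ := Module.Finite.exists_fin' R N
    exact Module.Finite.of_injective p.dualMap (LinearMap.dualMap_injective_of_surjective hp)
  refine (dualTensorHom_bijective_of_flat (R := R) (X := Module.Dual R N) (E := E)).comp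
    (f := (Module.Dual.eval R N).rTensor E) ⟨?_, ?_⟩
  · exact Module.Flat.rTensor_preserves_injective_linearMap _
      (Module.Dual.eval_injective_of_isQuasiFrobenius N)
  · exact LinearMap.rTensor_surjective E (Module.Dual.eval_surjective_of_isQuasiFrobenius N)

/-- Solving extension problems between finitely generated rational right modules by lifting
balanced tensors. -/
theorem LiftsBalanced.exists_extension (hP : P.AlphaCondition) [Module.Flat R E]
    (h : P.LiftsBalanced E) {X Y : Type u} [AddCommGroup X] [Module R X] [Module Aᵐᵒᵖ X]
    [IsScalarTower R Aᵐᵒᵖ X] [AddCommGroup Y] [Module R Y] [Module Aᵐᵒᵖ Y]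
    [IsScalarTower R Aᵐᵒᵖ Y] [Module.Finite R X] [Module.Finite R Y] (hX : P.IsRightRational X)
    (hY : P.IsRightRational Y) (i : X →ₗ[Aᵐᵒᵖ] Y) (hi : Function.Injective i)
    (f : X →ₗ[Aᵐᵒᵖ] P.RightModuleOf E) : ∃ g : Y →ₗ[Aᵐᵒᵖ] P.RightModuleOf E, g ∘ₗ i = f := by
  let _ := dualLeftModule (A := A) R X
  let _ := isScalarTower_dualLeftModule (A := A) R X
  let _ := dualLeftModule (A := A) R Y
  let _ := isScalarTower_dualLeftModule (A := A) R Y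
  let i' : Module.Dual R Y →ₗ[A] Module.Dual R X :=
    { (i.restrictScalars R).dualMap with
      map_smul' := fun a k => LinearMap.ext fun x =>
        congrArg k (i.map_smul (MulOpposite.op a) x).symm }
  let f' : X →ₗ[R] E := f.restrictScalars R
  have bX := dualTensorHom_bijective_of_flat (R := R) (X := X) (E := E)
  have bY := dualTensorHom_bijective_of_flat (R := R) (X := Y) (E := E)
  -- The map `f` is a balanced tensor in `X^* ⊗ E`, and extending it along `i` means lifting this
  -- tensor along `i'`, which is onto by self-injectivity.
  obtain ⟨t, ht⟩ := bX.2 f'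
  obtain ⟨s, hs, hst⟩ := h _ _ i'
    (isRational_iff.2 ((isRightRational_iff.1 hY).dual hP))
    (isRational_iff.2 ((isRightRational_iff.1 hX).dual hP))
    (LinearMap.dualMap_surjective_of_isQuasiFrobenius (i := i.restrictScalars R) hi) t
    ((isBalanced_dual_iff bX.1 t).2 fun a x => by
      rw [ht]
      exact f.map_smul (MulOpposite.op a) x)
  have hlin := (isBalanced_dual_iff bY.1 s).1 hs
  refine ⟨{ dualTensorHom R Y E s with map_smul' := fun a y => hlin a.unop y },
    LinearMap.ext fun x => ?_⟩
  have hcomp : dualTensorHom R Y E s ∘ₗ i.restrictScalars R = f' := by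
    rw [← dualTensorHom_naturality, ← ht, ← hst]
    rfl
  exact LinearMap.congr_fun hcomp x

/-- By local finiteness cyclic rational modules are finitely generated over the Noetherian ring `R`,
as are their submodules, so the Baer-type criterion leaves only the finitely generated case. -/
theorem LiftsBalanced.isInjectiveRightRational (hP : P.AlphaCondition) [Module.Flat R E]
    (h : P.LiftsBalanced E) : P.IsInjectiveRightRational (P.RightModuleOf E) := by
  refine ⟨isRightRational_rightModuleOf, fun X Y _ _ _ _ _ _ _ _ i f hX hY hi => ?_⟩
  refine LinearMap.exists_extension_of_forall_span_singleton i hi f fun y W k => ?_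
  have hfin : Module.Finite R (Submodule.span Aᵐᵒᵖ {y}) := by
    have := Submodule.finite_span_of_forall_exists_fg (R := R) (A' := Aᵐᵒᵖ) (X := Y)
      (fun x => by
        obtain ⟨V, hV, hmem⟩ := (isRightRational_iff.1 hY).exists_fg x
        exact ⟨V, hV, fun a => hmem a.unop⟩) {y}
    rwa [Finset.coe_singleton] at this
  have hS := hY.submodule hP (Submodule.span Aᵐᵒᵖ {y})
  have : Module.Finite R W :=
    Module.Finite.of_injective (W.subtype.restrictScalars R) W.subtype_injective
  exact h.exists_extension hP (hS.submodule hP W) hS W.subtype W.subtype_injective k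

/-- Lifting of balanced tensors along surjections of finitely generated rational modules. -/
theorem IsInjectiveRightRational.exists_lift (hP : P.AlphaCondition) [Module.Flat R E]
    (h : P.IsInjectiveRightRational (P.RightModuleOf E)) {M K : Type u}
    [AddCommGroup M] [Module R M] [Module A M] [IsScalarTower R A M]
    [AddCommGroup K] [Module R K] [Module A K] [IsScalarTower R A K]
    [Module.Finite R M] [Module.Finite R K] (g : M →ₗ[A] K)
    (hM : P.IsRational M) (hK : P.IsRational K) (hg : Function.Surjective g)
    (t : K ⊗[R] E) (ht : P.IsBalanced t) :
    ∃ s : M ⊗[R] E, P.IsBalanced s ∧ (g.restrictScalars R).rTensor E s = t := by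
  let _ := dualRightModule (A := A) R M
  let _ := isScalarTower_dualRightModule (A := A) R M
  let _ := dualRightModule (A := A) R K
  let _ := isScalarTower_dualRightModule (A := A) R K
  let g' : Module.Dual R K →ₗ[Aᵐᵒᵖ] Module.Dual R M :=
    { (g.restrictScalars R).dualMap with
      map_smul' := fun a k => LinearMap.ext fun x => congrArg k (g.map_smul a.unop x).symm }
  have bM := evalTensorHom_bijective (R := R) M E
  have bK := evalTensorHom_bijective (R := R) K E
  have hlin := (isBalanced_iff_evalTensorHom bK.1 t).1 ht
  let f : Module.Dual R K →ₗ[Aᵐᵒᵖ] P.RightModuleOf E :=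
    { evalTensorHom R K E t with map_smul' := fun a k => hlin a.unop k }
  -- The balanced tensor is now a linear map on `K^*`; it extends to `M^*`, and reflexivity converts
  -- the extension into a tensor in `M ⊗ E`.
  obtain ⟨f', hf'⟩ := h.2 _ _ g' f
    (isRightRational_iff.2 ((isRational_iff.1 hK).dual hP))
    (isRightRational_iff.2 ((isRational_iff.1 hM).dual hP))
    (LinearMap.dualMap_injective_of_surjective (f := g.restrictScalars R) hg)
  obtain ⟨s, hs⟩ := bM.2 (f'.restrictScalars R : Module.Dual R M →ₗ[R] E)
  refine ⟨s, (isBalanced_iff_evalTensorHom bM.1 s).2 fun a k => ?_, bK.1 ?_⟩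
  · rw [hs]
    exact f'.map_smul (MulOpposite.op a) k
  · rw [evalTensorHom_rTensor, hs]
    exact LinearMap.ext fun k => LinearMap.congr_fun hf' k

/-- A tensor involves finitely many elements of `K`. Their `A`-span and that of chosen preimages in
`M` are finitely generated over `R`, and flatness of `E` keeps the tensor balanced over the smaller
module. -/
theorem IsInjectiveRightRational.liftsBalanced (hP : P.AlphaCondition) [Module.Flat R E]
    (h : P.IsInjectiveRightRational (P.RightModuleOf E)) : P.LiftsBalanced E := by
  classical
  intro M K _ _ _ _ _ _ _ _ g hM hK hg t ht
  obtain ⟨S, hS⟩ := TensorProduct.exists_finset t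
  have hfin {N : Type u} [AddCommGroup N] [Module R N] [Module A N] [IsScalarTower R A N]
      (hN : P.IsRational N) (s : Finset N) : Module.Finite R (Submodule.span A (s : Set N)) :=
    Submodule.finite_span_of_forall_exists_fg (isRational_iff.1 hN).exists_fg s
  let σ := Function.surjInv hg
  let M' : Submodule A M := Submodule.span A ((S.image fun p => σ p.1 : Finset M) : Set M)
  let K' : Submodule A K := Submodule.span A ((S.image Prod.fst : Finset K) : Set K)
  have hMK : M'.map g = K' := by
    rw [Submodule.map_span]
    congr 1
    ext k
    simp [σ, Function.surjInv_eq hg]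
  have hmap : ∀ m ∈ M', g m ∈ K' := fun m hm => hMK ▸ Submodule.mem_map_of_mem hm
  let g' : M' →ₗ[A] K' := g.restrict hmap
  have hg' : Function.Surjective g' := by
    rintro ⟨k, hk⟩
    rw [← hMK] at hk
    obtain ⟨m, hm, rfl⟩ := hk
    exact ⟨⟨m, hm⟩, rfl⟩
  obtain ⟨t', rfl⟩ : ∃ t' : K' ⊗[R] E, (K'.subtype.restrictScalars R).rTensor E t' = t := by
    rw [hS, ← LinearMap.mem_range]
    refine Submodule.sum_mem _ fun p hp => ?_
    exact ⟨(⟨p.1, Submodule.subset_span (Finset.mem_image_of_mem _ hp)⟩ : K') ⊗ₜ p.2, by simp⟩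
  have := hfin hM (S.image fun p => σ p.1)
  have := hfin hK (S.image Prod.fst)
  obtain ⟨s, hs, rfl⟩ := h.exists_lift hP g' (hM.submodule hP M') (hK.submodule hP K') hg' t'
    (ht.of_rTensor K'.subtype K'.subtype_injective)
  refine ⟨(M'.subtype.restrictScalars R).rTensor E s, hs.rTensor M'.subtype, ?_⟩
  rw [← LinearMap.rTensor_comp_apply, ← LinearMap.rTensor_comp_apply]
  rfl

/-- A flat left comodule is injective as a rational right module if and only if balanced tensors
with it lift along surjections of rational modules. -/
theorem isInjectiveRightRational_iff_liftsBalanced (hP : P.AlphaCondition) [Module.Flat R E] :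
    P.IsInjectiveRightRational (P.RightModuleOf E) ↔ P.LiftsBalanced E :=
  ⟨fun h => h.liftsBalanced hP, fun h => h.isInjectiveRightRational hP⟩

end Injective

end MeasuringPairing

/-! ### Cofree comodules -/

section Cofree

variable (R D M : Type u) [CommRing R] [AddCommGroup D] [Module R D] [Coalgebra R D]
  [AddCommGroup M] [Module R M]

/-- With `lTensor_assoc_comul`, this reduces coassociativity of the cofree comodule to that of `D`,
`M` being a passive factor. -/
theorem LeftComodule.assoc_comul_rTensor (z : D ⊗[R] D) (m : M) :
    TensorProduct.assoc R D D (D ⊗[R] M) ((Coalgebra.comul (R := R) (A := D)).rTensor (D ⊗[R] M)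
      (TensorProduct.assoc R D D M (z ⊗ₜ m))) =
      (TensorProduct.assoc R D D M).toLinearMap.lTensor D (TensorProduct.assoc R D (D ⊗[R] D) M
        (TensorProduct.assoc R D D D
          ((Coalgebra.comul (R := R) (A := D)).rTensor D z) ⊗ₜ m)) := by
  induction z with
  | zero => simp
  | add x y hx hy => simp only [map_add, TensorProduct.add_tmul, hx, hy]
  | tmul x y =>
    simp only [TensorProduct.assoc_tmul, LinearMap.rTensor_tmul]
    generalize Coalgebra.comul (R := R) x = w
    induction w with
    | zero => simp
    | add x y hx hy => simp only [map_add, TensorProduct.add_tmul, hx, hy]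
    | tmul a b => simp

theorem LeftComodule.lTensor_assoc_comul (z : D ⊗[R] D) (m : M) :
    ((TensorProduct.assoc R D D M).toLinearMap ∘ₗ
      (Coalgebra.comul (R := R) (A := D)).rTensor M).lTensor D
        (TensorProduct.assoc R D D M (z ⊗ₜ m)) =
      (TensorProduct.assoc R D D M).toLinearMap.lTensor D (TensorProduct.assoc R D (D ⊗[R] D) M
        (((Coalgebra.comul (R := R) (A := D)).lTensor D z) ⊗ₜ m)) := by
  induction z with
  | zero => simp
  | add x y hx hy => simp only [map_add, TensorProduct.add_tmul, hx, hy]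
  | tmul x y => simp

/-- The cofree left `D`-comodule `D ⊗ M`. -/
@[reducible] noncomputable def LeftComodule.cofree : LeftComodule R D (D ⊗[R] M) where
  coact := (TensorProduct.assoc R D D M).toLinearMap ∘ₗ
    (Coalgebra.comul (R := R) (A := D)).rTensor M
  coassoc := by
    ext d m
    simp only [TensorProduct.AlgebraTensorModule.curry_apply, LinearMap.restrictScalars_self,
      TensorProduct.curry_apply, LinearMap.comp_apply, LinearEquiv.coe_coe,
      LinearMap.rTensor_tmul, LeftComodule.assoc_comul_rTensor, Coalgebra.coassoc_apply]
    exact (LeftComodule.lTensor_assoc_comul R D M _ m).symm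
  counital := by
    ext d m
    have h : ∀ z : D ⊗[R] D, TensorProduct.lid R (D ⊗[R] M)
        ((Coalgebra.counit (R := R) (A := D)).rTensor (D ⊗[R] M)
          (TensorProduct.assoc R D D M (z ⊗ₜ m))) =
        TensorProduct.lid R D ((Coalgebra.counit (R := R) (A := D)).rTensor D z) ⊗ₜ m := by
      intro z
      induction z with
      | zero => simp
      | add x y hx hy => simp only [map_add, TensorProduct.add_tmul, hx, hy]
      | tmul x y => simp [TensorProduct.smul_tmul']
    simp [h]

variable {R D M}

theorem LeftComodule.coact_injective [LeftComodule R D M] :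
    Function.Injective (LeftComodule.coact (R := R) (C := D) (M := M)) := by
  intro x y hxy
  have h := LeftComodule.counital (R := R) (C := D) (M := M)
  rw [← LinearMap.id_apply (R := R) x, ← LinearMap.id_apply (R := R) y, ← h]
  simp only [LinearMap.comp_apply, hxy]

/-- An injective comodule is a retract of a cofree comodule. -/
theorem LeftComodule.IsInjective.exists_retraction [LeftComodule R D M]
    (h : LeftComodule.IsInjective R D M) :
    letI := LeftComodule.cofree R D M
    ∃ p : D ⊗[R] M →ₗ[R] M, LeftComodule.IsColinear D p ∧
      p ∘ₗ LeftComodule.coact (R := R) (C := D) (M := M) = LinearMap.id := by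
  let _ := LeftComodule.cofree R D M
  -- The coaction is colinear by coassociativity and injective by the counit, so the identity
  -- extends along it.
  refine h M (D ⊗[R] M) LeftComodule.coact LinearMap.id LeftComodule.coassoc
    LeftComodule.coact_injective ?_
  rw [LeftComodule.IsColinear, LinearMap.lTensor_id, LinearMap.id_comp, LinearMap.comp_id]

/-- A coalgebra over a self-injective ring is injective as a comodule over itself. -/
theorem LeftComodule.isInjective_self (hR : Module.Injective R R) :
    LeftComodule.IsInjective R D D := by
  intro X Y _ _ _ _ _ _ i f hi hinj hf
  obtain ⟨h, hh⟩ := hR.exists_comp_eq i hinj (Coalgebra.counit (R := R) (A := D) ∘ₗ f)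
  -- The extension is `y ↦ ∑ h(y₀) y₋₁`, the colinear map whose composite with the counit is `h`.
  let e : D ⊗[R] Y →ₗ[R] D := (TensorProduct.rid R D).toLinearMap ∘ₗ h.lTensor D
  have he : Coalgebra.comul (R := R) (A := D) ∘ₗ e = e.lTensor D ∘ₗ
      (TensorProduct.assoc R D D Y).toLinearMap ∘ₗ
        (Coalgebra.comul (R := R) (A := D)).rTensor Y := by
    ext d y
    simp only [TensorProduct.AlgebraTensorModule.curry_apply, LinearMap.restrictScalars_self,
      TensorProduct.curry_apply, LinearMap.comp_apply, LinearEquiv.coe_coe,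
      LinearMap.rTensor_tmul, e, LinearMap.lTensor_tmul, TensorProduct.rid_tmul, map_smul]
    generalize Coalgebra.comul (R := R) d = z
    induction z with
    | zero => simp
    | add x y hx hy => simp only [map_add, smul_add, TensorProduct.add_tmul, hx, hy]
    | tmul a b => simp
  refine ⟨e ∘ₗ LeftComodule.coact, ?_, ?_⟩
  · change Coalgebra.comul (R := R) (A := D) ∘ₗ e ∘ₗ LeftComodule.coact = _
    rw [← LinearMap.comp_assoc, he, LinearMap.comp_assoc, LinearMap.comp_assoc,
      LeftComodule.coassoc, ← LinearMap.comp_assoc, ← LinearMap.lTensor_comp]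
  · have hf' : Coalgebra.comul (R := R) (A := D) ∘ₗ f = f.lTensor D ∘ₗ LeftComodule.coact := hf
    rw [LinearMap.comp_assoc, show LeftComodule.coact ∘ₗ i = _ from hi]
    ext x
    have h1 := LinearMap.congr_fun hf' x
    simp only [LinearMap.comp_apply, LinearEquiv.coe_coe, e] at h1 ⊢
    rw [← LinearMap.lTensor_comp_apply, hh, LinearMap.lTensor_comp_apply, ← h1]
    simp

end Cofree

namespace MeasuringPairing

/-! ### Stability of the lifting property under retracts and flat tensor factors -/

section Tensor

variable {R A C : Type u} [CommRing R] [Ring A] [Algebra R A]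
  [AddCommGroup C] [Module R C] [Coalgebra R C] {P : MeasuringPairing R A C}
  {E F : Type u} [AddCommGroup E] [Module R E] [LeftComodule R C E]
  [AddCommGroup F] [Module R F] [LeftComodule R C F]

theorem rightAct_apply_of_isColinear (f : E →ₗ[R] F) (hf : LeftComodule.IsColinear C f) (a : A)
    (x : E) : f (P.rightAct E a x) = P.rightAct F a (f x) := by
  have h := LinearMap.congr_fun hf x
  simp only [LinearMap.comp_apply] at h
  simp only [rightAct, LinearMap.comp_apply, h]
  generalize LeftComodule.coact (R := R) (C := C) x = z
  induction z with
  | zero => simp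
  | add x y hx hy => simp only [map_add, hx, hy]
  | tmul a b => simp

theorem rightAct_cofree (a : A) (V : Type u) [AddCommGroup V] [Module R V] :
    letI := LeftComodule.cofree R C V
    P.rightAct (C ⊗[R] V) a = (P.rightAct C a).rTensor V := by
  let _ := LeftComodule.cofree R C V
  ext c v
  change TensorProduct.lid R (C ⊗[R] V) ((P.form a).rTensor (C ⊗[R] V)
    (TensorProduct.assoc R C C V (Coalgebra.comul (R := R) c ⊗ₜ v))) =
      TensorProduct.lid R C ((P.form a).rTensor C (Coalgebra.comul (R := R) c)) ⊗ₜ v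
  generalize Coalgebra.comul (R := R) c = z
  induction z with
  | zero => simp
  | add x y hx hy => simp only [map_add, TensorProduct.add_tmul, hx, hy]
  | tmul x y => simp [TensorProduct.smul_tmul']

theorem LiftsBalanced.of_retract (h : P.LiftsBalanced F) (j : E →ₗ[R] F) (p : F →ₗ[R] E)
    (hj : ∀ a x, j (P.rightAct E a x) = P.rightAct F a (j x))
    (hp : ∀ a x, p (P.rightAct F a x) = P.rightAct E a (p x)) (hpj : p ∘ₗ j = LinearMap.id) :
    P.LiftsBalanced E := by
  intro M K _ _ _ _ _ _ _ _ g hM hK hg t ht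
  obtain ⟨s, hs, hst⟩ := h M K g hM hK hg _ (ht.lTensor j hj)
  refine ⟨p.lTensor M s, hs.lTensor p hp, ?_⟩
  rw [← lTensor_rTensor_comm, hst, ← LinearMap.lTensor_comp_apply, hpj, LinearMap.lTensor_id,
    LinearMap.id_apply]

/-- Reassociating absorbs `V` into the last factor, where `ext_evalMiddle` applies. -/
theorem ext_evalMiddle_rTensor (hP : P.AlphaCondition) {K N V : Type u} [AddCommGroup K]
    [Module R K] [AddCommGroup N] [Module R N] [AddCommGroup V] [Module R V]
    {z : (K ⊗[R] (C ⊗[R] N)) ⊗[R] V} (h : ∀ a, (P.evalMiddle K N a).rTensor V z = 0) : z = 0 := by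
  let σ : (K ⊗[R] (C ⊗[R] N)) ⊗[R] V ≃ₗ[R] K ⊗[R] (C ⊗[R] (N ⊗[R] V)) :=
    TensorProduct.assoc R K (C ⊗[R] N) V ≪≫ₗ
      TensorProduct.congr (LinearEquiv.refl R K) (TensorProduct.assoc R C N V)
  have hσ : ∀ a, P.evalMiddle K (N ⊗[R] V) a ∘ₗ σ.toLinearMap =
      (TensorProduct.assoc R K N V).toLinearMap ∘ₗ (P.evalMiddle K N a).rTensor V := by
    intro a
    ext k c e v
    simp [σ, evalMiddle, ← TensorProduct.smul_tmul', TensorProduct.tmul_smul]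
  apply σ.injective
  refine ext_evalMiddle hP fun a => ?_
  refine (LinearMap.congr_fun (hσ a) z).trans ?_
  simp [h]

/-- Tensoring with a flat module preserves the lifting of balanced tensors. -/
theorem LiftsBalanced.tensor (hP : P.AlphaCondition) (h : P.LiftsBalanced E) {V : Type u}
    [AddCommGroup V] [Module R V] [Module.Flat R V] (e : E ⊗[R] V ≃ₗ[R] F)
    (he : ∀ a x, e ((P.rightAct E a).rTensor V x) = P.rightAct F a (e x)) :
    P.LiftsBalanced F := by
  intro M K _ _ _ _ _ _ _ _ g hM hK hg t ht
  obtain ⟨_, hKc⟩ := hK.exists_rightComodule hP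
  -- The kernel of `δ` is the module of balanced tensors in `K ⊗ E`.
  let δ : K ⊗[R] E →ₗ[R] K ⊗[R] (C ⊗[R] E) :=
    (TensorProduct.assoc R K C E).toLinearMap ∘ₗ
        (RightComodule.coact (R := R) (C := C) (M := K)).rTensor E -
      (LeftComodule.coact (R := R) (C := C) (M := E)).lTensor K
  let τ : (K ⊗[R] E) ⊗[R] V ≃ₗ[R] K ⊗[R] F :=
    TensorProduct.assoc R K E V ≪≫ₗ TensorProduct.congr (LinearEquiv.refl R K) e
  have hδ : ∀ a, P.evalMiddle K E a ∘ₗ δ =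
      (Algebra.lsmul R R K a : Module.End R K).rTensor E - (P.rightAct E a).lTensor K := by
    intro a
    ext k x
    have h1 := evalMiddle_assoc (P := P) (RightComodule.coact (R := R) (C := C) (M := K)) a
      (k ⊗ₜ[R] x)
    have h2 := evalMiddle_coact (P := P) a (k ⊗ₜ[R] x)
    simp only [LinearMap.rTensor_tmul, LinearMap.lTensor_tmul] at h1 h2
    simp [δ, h1, h2, hKc k a]
  have h1 : ∀ (a : A), τ.toLinearMap ∘ₗ
      ((Algebra.lsmul R R K a : Module.End R K).rTensor E).rTensor V =
        (Algebra.lsmul R R K a : Module.End R K).rTensor F ∘ₗ τ.toLinearMap := by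
    intro a
    ext k x v
    simp [τ]
  have h2 : ∀ (a : A), τ.toLinearMap ∘ₗ ((P.rightAct E a).lTensor K).rTensor V =
        (P.rightAct F a).lTensor K ∘ₗ τ.toLinearMap := by
    intro a
    ext k x v
    simp [τ, ← he]
  obtain ⟨t, rfl⟩ := τ.surjective t
  have h0 : δ.rTensor V t = 0 := by
    refine ext_evalMiddle_rTensor hP fun a => τ.injective ?_
    rw [← LinearMap.rTensor_comp_apply, hδ, LinearMap.rTensor_sub, LinearMap.sub_apply, map_sub,
      map_zero, sub_eq_zero]
    exact (LinearMap.congr_fun (h1 a) t).trans ((ht a).trans (LinearMap.congr_fun (h2 a) t).symm)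
  -- Flatness of `V` makes `t` a sum of tensors `b ⊗ v` with `b` balanced; lifting each `b` lifts
  -- `t`.
  obtain ⟨w, rfl⟩ := (Module.Flat.rTensor_exact V (LinearMap.exact_subtype_ker_map δ) t).1 h0
  clear h0 ht
  induction w with
  | zero => exact ⟨0, fun a => by simp, by simp⟩
  | add x y hx hy =>
    obtain ⟨s, hs, hsx⟩ := hx
    obtain ⟨s', hs', hsy⟩ := hy
    exact ⟨s + s', fun a => by simp only [map_add, hs a, hs' a], by simp only [map_add, hsx, hsy]⟩
  | tmul b v =>
    obtain ⟨s, hs, hsb⟩ := h M K g hM hK hg b.1 ((mem_cotensor_iff_isBalanced hP hKc b.1).1 b.2)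
    let k : E →ₗ[R] F := e.toLinearMap ∘ₗ (TensorProduct.mk R E V).flip v
    refine ⟨k.lTensor M s, hs.lTensor k fun a x => ?_, ?_⟩
    · refine Eq.trans ?_ (he a (x ⊗ₜ v))
      simp [k]
    · rw [← lTensor_rTensor_comm, hsb]
      have : k.lTensor K = τ.toLinearMap ∘ₗ (TensorProduct.mk R (K ⊗[R] E) V).flip v := by
        ext y x
        simp [k, τ]
      exact LinearMap.congr_fun this b.1

end Tensor

section Coinduction

variable {R A B C D : Type u} [CommRing R] [Ring A] [Algebra R A] [Ring B] [Algebra R B]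
  [AddCommGroup C] [Module R C] [Coalgebra R C] [AddCommGroup D] [Module R D] [Coalgebra R D]
  {P : MeasuringPairing R A C} {Q : MeasuringPairing R B D}

/-- If balanced tensors with `D` lift, then so do balanced tensors with every flat injective
`D`-comodule. -/
theorem LiftsBalanced.corestrict_of_isInjective (hP : P.AlphaCondition) (φ : Hom Q P)
    (h : P.LiftsBalanced (Corestrict φ.θ D)) (M : Type u) [AddCommGroup M] [Module R M]
    [LeftComodule R D M] [Module.Flat R M] (hM : LeftComodule.IsInjective R D M) :
    P.LiftsBalanced (Corestrict φ.θ M) := by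
  let _ := LeftComodule.cofree R D M
  obtain ⟨p, hp, hpj⟩ := hM.exists_retraction
  -- On the cofree comodule `A` acts through the factor `D` alone.
  have h1 : P.LiftsBalanced (Corestrict φ.θ (D ⊗[R] M)) := by
    refine h.tensor hP (V := M) (LinearEquiv.refl R (D ⊗[R] M)) fun a x => ?_
    rw [rightAct_corestrict, rightAct_corestrict, rightAct_cofree]
    rfl
  refine h1.of_retract (E := Corestrict φ.θ M) (LeftComodule.coact (R := R) (C := D) (M := M)) p
    (fun a x => ?_) (fun a x => ?_) hpj
  · rw [rightAct_corestrict, rightAct_corestrict]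
    exact rightAct_apply_of_isColinear (P := Q) (E := M) (F := D ⊗[R] M) LeftComodule.coact
      LeftComodule.coassoc _ _
  · rw [rightAct_corestrict, rightAct_corestrict]
    exact rightAct_apply_of_isColinear (P := Q) (E := D ⊗[R] M) (F := M) p hp _ _

end Coinduction

end MeasuringPairing

/-! ### The four equivalent conditions -/

theorem mainTheorem9 {R A B C D : Type u} [CommRing R] [IsQuasiFrobenius R]
    [Ring A] [Algebra R A] [Ring B] [Algebra R B]
    [AddCommGroup C] [Module R C] [Coalgebra R C] [AddCommGroup D] [Module R D] [Coalgebra R D]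
    (P : MeasuringPairing R A C) (Q : MeasuringPairing R B D)
    (hP : P.AlphaCondition) (hQ : Q.AlphaCondition) (φ : MeasuringPairing.Hom Q P) :
    List.TFAE [
      Coind.IsExact φ,
      LeftComodule.IsCoflat R C (Corestrict φ.θ D),
      P.IsInjectiveRightRational (P.RightModuleOf (Corestrict φ.θ D)),
      ∀ (M : Type u) [AddCommGroup M] [Module R M] [LeftComodule R D M],
        Module.Flat R M → LeftComodule.IsInjective R D M →
        P.IsInjectiveRightRational (P.RightModuleOf (Corestrict φ.θ M))] := by
  have hD : Module.Flat R (Corestrict φ.θ D) := Q.flat_of_alphaCondition hQ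
  have h31 := MeasuringPairing.isInjectiveRightRational_iff_liftsBalanced
    (E := Corestrict φ.θ D) hP
  tfae_have 1 ↔ 3 := (MeasuringPairing.isExact_coind_iff_liftsBalanced φ hP hQ).trans h31.symm
  tfae_have 2 ↔ 3 := (MeasuringPairing.isCoflat_iff_liftsBalanced hP).trans h31.symm
  tfae_have 3 → 4 := by
    intro h M _ _ _ hM hinj
    have : Module.Flat R (Corestrict φ.θ M) := hM
    exact ((h31.1 h).corestrict_of_isInjective hP φ M hinj).isInjectiveRightRational hP
  -- Apply condition 4 to `D` itself, which is flat and injective as a comodule over itself.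
  tfae_have 4 → 3 := fun h =>
    h D (Q.flat_of_alphaCondition hQ)
      (LeftComodule.isInjective_self IsQuasiFrobenius.selfInjective)
  tfae_finish
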